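/- \textbf{The exponential map of the $\alpha$-warped Segre--Veronese manifold.} Let $\alpha>0$, let $n_1,\dots,n_d$ be natural numbers and let $k_1,\dots,k_d\ge 1$ be integers. On $\mathbb{R}^{n_1^{k_1}\times\cdots\times n_d^{k_d}}$ use the Euclidean inner product. Let $$\otimes(\lambda,\mathbf u_1,\dots,\mathbf u_d)=\lambda\,\mathbf u_1^{\otimes k_1}\otimes\cdots\otimes\mathbf u_d^{\otimes k_d}.$$ The \emph{pre-Segre--Veronese manifold} $\mathcal P_\alpha^{\mathbf k}$ is $\mathbb{R}_{>0}\times\mathbb{S}^{n_1-1}\times\cdots\times\mathbb{S}^{n_d-1}$ with the metric $$g_{(\lambda,\mathbf u_1,\dots,\mathbf u_d)}\bigl((\dot x,\dot{\mathbf u}_1,\dots,\dot{\mathbf u}_d),(\dot y,\dot{\mathbf v}_1,\dots,\dot{\mathbf v}_d)\bigr)=\dot x\dot y+(\alpha\lambda)^2\sum_{i=1}^d k_i\langle\dot{\mathbf u}_i,\dot{\mathbf v}_i\rangle .$$ The \emph{Segre--Veronese manifold} $\mathcal S_\alpha^{\mathbf k}$ is the image of $\otimes$ on $\mathbb{R}_{>0}\times\mathbb{S}^{n_1-1}\times\cdots\times\mathbb{S}^{n_d-1}$,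 with the metric induced by the $\alpha$-warped metric of the punctured tensor space, $$\varsigma^\alpha_{\lambda\,\mathcal U}(\dot x\,\mathcal U+\lambda\dot{\mathcal V},\dot y\,\mathcal U+\lambda\dot{\mathcal W})=\dot x\dot y+(\alpha\lambda)^2\langle\dot{\mathcal V},\dot{\mathcal W}\rangle\qquad(\lambda>0,\ \|\mathcal U\|=1,\ \dot{\mathcal V},\dot{\mathcal W}\perp\mathcal U).$$ For both manifolds, $\exp_x(v)=\gamma(1)$, where $\gamma$ is the constant-speed geodesic with $\gamma(0)=x$ and $\gamma'(0)=v$; the domain of $\exp_x$ consists of those tangent vectors $v$ at $x$ for which $\gamma$ exists on $[0,1]$. Let $\mathcal P\in\mathcal S_\alpha^{\mathbf k}$ and let $p=(\lambda,\mathbf u_1,\dots,\mathbf u_d)\in\mathcal P_\alpha^{\mathbf k}$ be any point with $\otimes(p)=\mathcal P$. Then the following hold. (1) Every $\dot{\mathcal P}\in \mathrm T_{\mathcal P}\mathcal S_\alpha^{\mathbf k}$ can be written in exactly one way as $$\dot{\mathcal P}=\dot\lambda\,\mathcal U+\lambda\sum_{i=1}^d \mathbf u_1^{\otimes k_1}\otimes\cdots\otimes\mathbf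 u_{i-1}^{\otimes k_{i-1}}\otimes\nu_{k_i}(\dot{\mathbf u}_i)\otimes\mathbf u_{i+1}^{\otimes k_{i+1}}\otimes\cdots\otimes\mathbf u_d^{\otimes k_d}$$ with $\dot p=(\dot\lambda,\dot{\mathbf u}_1,\dots,\dot{\mathbf u}_d)\in \mathrm T_p\mathcal P_\alpha^{\mathbf k}$, where $\mathcal U=\mathbf u_1^{\otimes k_1}\otimes\cdots\otimes\mathbf u_d^{\otimes k_d}$ and $\nu_{k_i}(\dot{\mathbf u}_i)=\dot{\mathbf u}_i\otimes\mathbf u_i^{\otimes(k_i-1)}+\cdots+\mathbf u_i^{\otimes(k_i-1)}\otimes\dot{\mathbf u}_i$ (the sum over the $k_i$ positions of $\dot{\mathbf u}_i$). (2) The domain of $\exp_p$ is $\mathrm T_p\mathcal P_\alpha^{\mathbf k}\setminus\{(\dot\lambda,0,\dots,0)\mid\dot\lambda\le-\lambda\}$. For $\dot p$ in it, put $N=\sqrt{\sum_{i=1}^d k_i\|\dot{\mathbf u}_i\|^2}$. If $N=0$, then $\exp_p(\dot p)=(\lambda+\dot\lambda,\mathbf u_1,\dots,\mathbf u_d)$.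 If $N>0$, then $$\exp_p(\dot p)=\Bigl(\sqrt{(\lambda+\dot\lambda)^2+(\lambda\alpha N)^2},\ \mathbf u_1\cos a_1+\tfrac{\dot{\mathbf u}_1}{\|\dot{\mathbf u}_1\|}\sin a_1,\ \dots,\ \mathbf u_d\cos a_d+\tfrac{\dot{\mathbf u}_d}{\|\dot{\mathbf u}_d\|}\sin a_d\Bigr),$$ $$a_i=\frac{\|\dot{\mathbf u}_i\|}{\alpha N}\Bigl(\frac{\pi}{2}-\arctan\frac{\lambda+\dot\lambda}{\lambda\alpha N}\Bigr),$$ where $\tfrac{\dot{\mathbf u}_i}{\|\dot{\mathbf u}_i\|}\sin a_i$ is read as $0$ if $\dot{\mathbf u}_i=0$. (3) If $\dot{\mathcal P}$ and $\dot p$ are as in (1) and $\dot p$ lies in the domain of $\exp_p$, then $\dot{\mathcal P}$ lies in the domain of $\exp_{\mathcal P}$ and $$\exp_{\mathcal P}(\dot{\mathcal P})=\otimes(\exp_p(\dot p)).$$ -/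

import Mathlib

open Real Set
open scoped ContDiff

noncomputable section

namespace SegreVeronese

/-! ### Riemannian geometry of subsets of a vector space

A Riemannian metric on (an open part of) a vector space `E` is written as a function
`g : E → E → E → ℝ`, where `g x v w` is the inner product of `v` and `w` at `x`. A submanifold
`M` of `E` carries the metric that `g` induces on its tangent spaces. -/

section Geometry

variable {E F : Type*} [NormedAddCommGroup E] [NormedSpace ℝ E]
  [NormedAddCommGroup F] [NormedSpace ℝ F]

/-- The tangent space of an embedded submanifold `M` at `x`: the velocities at time `0` of the
smooth curves in `M` that pass through `x` at time `0`. -/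
def tangentSpaceAt (M : Set E) (x : E) : Set E :=
  {v | ∃ (ε : ℝ) (c : ℝ → E), 0 < ε ∧ ContDiffOn ℝ ∞ c (Ioo (-ε) ε) ∧
    (∀ t ∈ Ioo (-ε) ε, c t ∈ M) ∧ c 0 = x ∧ HasDerivAt c v 0}

/-- The Christoffel symbol of the first kind of the metric `g` at `x`,
`½ (D_u g(v, w) + D_v g(u, w) - D_w g(u, v))`, which is `g(Γ(u, v), w)`. -/
def christoffel (g : E → E → E → ℝ) (x u v w : E) : ℝ :=
  (fderiv ℝ (fun y => g y v w) x u + fderiv ℝ (fun y => g y u w) x v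
    - fderiv ℝ (fun y => g y u v) x w) / 2

/-- The inner product `g(D_t γ', w)` at time `t` of `w` with the covariant acceleration
`D_t γ' = γ'' + Γ(γ', γ')` of the curve `γ`, for the Levi-Civita connection of `g`. -/
def covariantAcceleration (g : E → E → E → ℝ) (γ : ℝ → E) (t : ℝ) (w : E) : ℝ :=
  g (γ t) (deriv (deriv γ) t) w + christoffel g (γ t) (deriv γ t) (deriv γ t) w

/-- `γ` is, on the open interval `I`, a (constant-speed) geodesic of the Riemannian submanifold
`M`. The Levi-Civita connection of `M` is the tangential part of that of the ambient metric, so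
the covariant acceleration of `γ` in `M` vanishes if and only if its ambient covariant
acceleration is orthogonal to the tangent space of `M`. -/
structure IsGeodesicOn (M : Set E) (g : E → E → E → ℝ) (I : Set ℝ) (γ : ℝ → E) : Prop where
  smooth : ContDiffOn ℝ ∞ γ I
  mem : ∀ t ∈ I, γ t ∈ M
  acceleration_eq_zero : ∀ t ∈ I, ∀ w ∈ tangentSpaceAt M (γ t), covariantAcceleration g γ t w = 0

/-- `γ` is a geodesic of `M` with `γ(0) = x` and `γ'(0) = v`, defined on an open interval that
contains `[0, 1]`. -/
def IsStartingGeodesic (M : Set E) (g : E → E → E → ℝ) (x v : E) (γ : ℝ → E) : Prop :=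
  γ 0 = x ∧ deriv γ 0 = v ∧ ∃ a b : ℝ, a < 0 ∧ 1 < b ∧ IsGeodesicOn M g (Ioo a b) γ

/-- The domain of the exponential map of `M` at `x`. -/
def expDomain (M : Set E) (g : E → E → E → ℝ) (x : E) : Set E :=
  {v | ∃ γ : ℝ → E, IsStartingGeodesic M g x v γ}

/-- The exponential map of `M` at `x`: the value at time `1` of the geodesic that starts at `x`
with velocity `v`. It is meaningful for `v ∈ expDomain M g x`. -/
def expMap (M : Set E) (g : E → E → E → ℝ) (x v : E) : E :=
  Classical.epsilon (IsStartingGeodesic M g x v) 1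

/-- The metric of the warped product with warping function `f`. -/
def warpedMetric (f : E → ℝ) (g : E → E → E → ℝ) (h : F → F → F → ℝ) :
    E × F → E × F → E × F → ℝ :=
  fun p v w => g p.1 v.1 w.1 + f p.1 ^ 2 * h p.2 v.2 w.2

end Geometry

section Euclidean

variable {V : Type*} [NormedAddCommGroup V] [InnerProductSpace ℝ V]

/-- The Euclidean metric. -/
def euclideanMetric (V : Type*) [NormedAddCommGroup V] [InnerProductSpace ℝ V] :
    V → V → V → ℝ :=
  fun _ v w => inner ℝ v w

/-- The identification of a nonzero `a` with the pair `(‖a‖, a / ‖a‖)`. -/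
def polar (a : V) : ℝ × V := (‖a‖, ‖a‖⁻¹ • a)

/-- The differential of `polar` at `a`: for `a = r u` with `r > 0` and `u` a unit vector, the
vector `x u + r v`, where `v` is orthogonal to `u`, is sent to `(x, v)`. -/
def polarTangent (a v : V) : ℝ × V :=
  (inner ℝ (polar a).2 v, ‖a‖⁻¹ • (v - inner ℝ (polar a).2 v • (polar a).2))

/-- The `α`-warped metric of the punctured space `V \ {0}`, identified with the warped product of
the positive reals and the unit sphere with warping function `x ↦ α x`. -/
def alphaMetric (α : ℝ) : V → V → V → ℝ := fun a v w =>
  warpedMetric (fun x : ℝ => α * x) (euclideanMetric ℝ) (euclideanMetric V)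
    (polar a) (polarTangent a v) (polarTangent a w)

theorem alphaMetric_polar (α r x y : ℝ) (hr : 0 < r) (u v w : V) (hu : ‖u‖ = 1)
    (hv : inner ℝ u v = 0) (hw : inner ℝ u w = 0) :
    alphaMetric α (r • u) (x • u + r • v) (y • u + r • w)
      = x * y + (α * r) ^ 2 * inner ℝ v w := by
  have huu : inner ℝ u u = (1 : ℝ) := by rw [real_inner_self_eq_norm_sq, hu]; norm_num
  have hn : ‖r • u‖ = r := by rw [norm_smul, hu, mul_one, Real.norm_of_nonneg hr.le]
  have hp : (polar (r • u)).2 = u := by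
    simp only [polar, hn, smul_smul, inv_mul_cancel₀ hr.ne', one_smul]
  have ht : ∀ (z : ℝ) (q : V), inner ℝ u q = (0 : ℝ) →
      polarTangent (r • u) (z • u + r • q) = (z, q) := by
    intro z q hq
    simp only [polarTangent, hp, hn, inner_add_right, inner_smul_right, huu, hq, mul_one,
      mul_zero, add_zero, add_sub_cancel_left, smul_smul, inv_mul_cancel₀ hr.ne', one_smul]
  simp only [alphaMetric, ht x v hv, ht y w hw, warpedMetric, euclideanMetric, polar, hn]
  simp [mul_comm]

end Euclidean

section Tensors

variable {d : ℕ}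

/-- Order-`m` arrays of size `n × ⋯ × n`, with the Euclidean inner product. -/
abbrev PowArray (m n : ℕ) : Type := EuclideanSpace ℝ (Fin m → Fin n)

/-- Arrays of size `n_1^{k_1} × ⋯ × n_d^{k_d}`, with the Euclidean inner product. -/
abbrev TensorSpace (n k : Fin d → ℕ) : Type :=
  EuclideanSpace ℝ ((i : Fin d) → Fin (k i) → Fin (n i))

/-- The product `ℝ × ℝ^{n_1} × ⋯ × ℝ^{n_d}`. -/
abbrev FactorSpace (n : Fin d → ℕ) : Type :=
  ℝ × ((i : Fin d) → EuclideanSpace ℝ (Fin (n i)))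

/-- The tensor product `x_1 ⊗ ⋯ ⊗ x_m` of vectors, as an array. -/
def vecTensor {m n : ℕ} (x : Fin m → EuclideanSpace ℝ (Fin n)) : PowArray m n :=
  WithLp.toLp 2 fun j => ∏ l, x l (j l)

/-- The tensor power `x^{⊗ m}`. -/
def tensorPow {n : ℕ} (m : ℕ) (x : EuclideanSpace ℝ (Fin n)) : PowArray m n :=
  vecTensor fun _ => x

/-- `ν_m(v) = v ⊗ u ⊗ ⋯ ⊗ u + ⋯ + u ⊗ ⋯ ⊗ u ⊗ v`, the sum over the `m` positions of `v`. -/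
def nu {n : ℕ} (m : ℕ) (u v : EuclideanSpace ℝ (Fin n)) : PowArray m n :=
  ∑ l : Fin m, vecTensor (Function.update (fun _ => u) l v)

/-- The tensor product `A_1 ⊗ ⋯ ⊗ A_d` of arrays. -/
def arrayTensor {n k : Fin d → ℕ} (A : (i : Fin d) → PowArray (k i) (n i)) : TensorSpace n k :=
  WithLp.toLp 2 fun j => ∏ i, A i (j i)

/-- The map `⊗ : (r, u_1, …, u_d) ↦ r u_1^{⊗ k_1} ⊗ ⋯ ⊗ u_d^{⊗ k_d}`. -/
def segreVeroneseMap {n : Fin d → ℕ} (k : Fin d → ℕ) (p : FactorSpace n) : TensorSpace n k :=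
  p.1 • arrayTensor fun i => tensorPow (k i) (p.2 i)

/-- The tangent vector
`r' U + r (ν_{k_1}(u'_1) ⊗ u_2^{⊗ k_2} ⊗ ⋯ ⊗ u_d^{⊗ k_d} + ⋯
  + u_1^{⊗ k_1} ⊗ ⋯ ⊗ u_{d-1}^{⊗ k_{d-1}} ⊗ ν_{k_d}(u'_d))`,
where `U = u_1^{⊗ k_1} ⊗ ⋯ ⊗ u_d^{⊗ k_d}`, `p = (r, u_1, …, u_d)` and `v = (r', u'_1, …, u'_d)`. -/
def tangentTensor {n : Fin d → ℕ} (k : Fin d → ℕ) (p v : FactorSpace n) : TensorSpace n k :=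
  v.1 • (arrayTensor fun i => tensorPow (k i) (p.2 i)) +
    p.1 • ∑ i, arrayTensor
      (Function.update (fun i => tensorPow (k i) (p.2 i)) i (nu (k i) (p.2 i) (v.2 i)))

/-- The pre-Segre–Veronese manifold `ℝ_{>0} × 𝕊^{n_1 - 1} × ⋯ × 𝕊^{n_d - 1}`. -/
def preSV (n : Fin d → ℕ) : Set (FactorSpace n) :=
  {p | 0 < p.1 ∧ ∀ i, ‖p.2 i‖ = 1}

/-- The metric of the product of the spheres `(𝕊^{n_i - 1}, k_i ⟨·, ·⟩)`. -/
def spheresMetric (n k : Fin d → ℕ) :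
    ((i : Fin d) → EuclideanSpace ℝ (Fin (n i))) →
    ((i : Fin d) → EuclideanSpace ℝ (Fin (n i))) →
    ((i : Fin d) → EuclideanSpace ℝ (Fin (n i))) → ℝ :=
  fun _ v w => ∑ i, (k i : ℝ) * inner ℝ (v i) (w i)

/-- The `α`-warped metric of the pre-Segre–Veronese manifold. -/
def preSVMetric (α : ℝ) (n k : Fin d → ℕ) :
    FactorSpace n → FactorSpace n → FactorSpace n → ℝ :=
  warpedMetric (fun x : ℝ => α * x) (euclideanMetric ℝ) (spheresMetric n k)

/-- The (positive) Segre–Veronese manifold of partially symmetric rank-`1` tensors. -/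
def segreVeronese (n k : Fin d → ℕ) : Set (TensorSpace n k) :=
  segreVeroneseMap k '' preSV n

/-- `N = √(k_1 ‖u'_1‖² + ⋯ + k_d ‖u'_d‖²)`. -/
def sphericalSpeed {n : Fin d → ℕ} (k : Fin d → ℕ) (v : FactorSpace n) : ℝ :=
  √(∑ i, (k i : ℝ) * ‖v.2 i‖ ^ 2)

/-- The angle
`a_i = ‖u'_i‖ / (α N) * (π / 2 - arctan ((r + r') / (r α N)))`. -/
def expAngle {n : Fin d → ℕ} (α : ℝ) (k : Fin d → ℕ) (p v : FactorSpace n) (i : Fin d) : ℝ :=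
  ‖v.2 i‖ / (α * sphericalSpeed k v) *
    (π / 2 - arctan ((p.1 + v.1) / (p.1 * α * sphericalSpeed k v)))

open Classical in
/-- The closed formula for the exponential map of the `α`-warped pre-Segre–Veronese manifold. The
summand `(u'_i / ‖u'_i‖) sin a_i` is `0` if `u'_i = 0`. -/
def preSVExpFormula {n : Fin d → ℕ} (α : ℝ) (k : Fin d → ℕ) (p v : FactorSpace n) :
    FactorSpace n :=
  if sphericalSpeed k v = 0 then (p.1 + v.1, p.2)
  else (√((p.1 + v.1) ^ 2 + (p.1 * α * sphericalSpeed k v) ^ 2),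
    fun i => cos (expAngle α k p v i) • p.2 i +
      sin (expAngle α k p v i) • (‖v.2 i‖⁻¹ • v.2 i))

end Tensors

end SegreVeronese

end

open SegreVeronese

namespace SegreVeronese

variable {d : ℕ}

/-! ### Rank-one tensors -/

/-! The map `segreVeroneseMap` is a local isometry, so it suffices to solve the geodesic equation on
the pre-Segre–Veronese manifold and to transport solutions in both directions.

Upstairs the metric is that of a cone over a product of spheres. A geodesic sweeps out a flat
sector, which unrolls to the straight line `z(t) = (r + t r') + i t r α N` in the plane: `|z|` is
the radius, and the `i`-th direction turns along a great circle by `‖u'_i‖ / (α N)` times `arg z`.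
At `t = 1` this is the closed formula, and it fails on `[0, 1]` only if the line runs into the apex,
that is, if `N = 0` and `r' ≤ -r`. Uniqueness comes from conservation laws instead of the general
theory of differential equations (`IsGeodesicOn.eqOn`).

The isometry is used to second order: a curve and its image have the same covariant acceleration
when tested against corresponding tangent vectors (`covariantAcceleration_segreVeroneseMap`). Inner
products of rank-one tensors are products of inner products, which reduces this to jets of real
functions.

The map may fail to be injective, because signs of directions can cancel. Requiring acute angles
with a base point fixes the signs, and there contractions recover the directions, which gives a
smooth left inverse. Hence curves downstairs lift locally (`exists_lift`). Lifting identifies the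
tangent spaces and gives local uniqueness of geodesics downstairs, and connectedness of the interval
makes it global (`eqOn_segreVeroneseMap_comp`). -/

theorem hasDerivAt_euclideanSpace {ι : Type*} [Fintype ι] {c : ℝ → EuclideanSpace ℝ ι}
    {v : EuclideanSpace ℝ ι} {t : ℝ} :
    HasDerivAt c v t ↔ ∀ i, HasDerivAt (fun s => c s i) (v i) t := by
  refine ⟨fun h i => (PiLp.hasFDerivAt_apply (𝕜 := ℝ) 2 (c t) i).comp_hasDerivAt t h, fun h => ?_⟩
  exact (PiLp.hasFDerivAt_toLp (𝕜 := ℝ) 2 (fun i => c t i)).comp_hasDerivAt t (hasDerivAt_pi.2 h)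

theorem inner_vecTensor {m n : ℕ} (x y : Fin m → EuclideanSpace ℝ (Fin n)) :
    inner ℝ (vecTensor x) (vecTensor y) = ∏ l, inner ℝ (x l) (y l) := by
  simp only [PiLp.inner_apply, vecTensor, RCLike.inner_apply, conj_trivial, Finset.prod_univ_sum,
    Fintype.piFinset_univ, Finset.prod_mul_distrib]

theorem inner_arrayTensor {n k : Fin d → ℕ} (A B : (i : Fin d) → PowArray (k i) (n i)) :
    inner ℝ (arrayTensor A) (arrayTensor B) = ∏ i, inner ℝ (A i) (B i) := by
  simp only [PiLp.inner_apply, arrayTensor, RCLike.inner_apply, conj_trivial,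
    Finset.prod_univ_sum, Fintype.piFinset_univ, Finset.prod_mul_distrib]

theorem inner_tensorPow {n : ℕ} (m : ℕ) (x y : EuclideanSpace ℝ (Fin n)) :
    inner ℝ (tensorPow m x) (tensorPow m y) = inner ℝ x y ^ m := by
  simp [tensorPow, inner_vecTensor]

theorem inner_tensorPow_nu {n : ℕ} (m : ℕ) (x u v : EuclideanSpace ℝ (Fin n)) :
    inner ℝ (tensorPow m x) (nu m u v) = m * inner ℝ x u ^ (m - 1) * inner ℝ x v := by
  have h : ∀ l : Fin m, inner ℝ (tensorPow m x) (vecTensor (Function.update (fun _ => u) l v))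
      = inner ℝ x u ^ (m - 1) * inner ℝ x v := by
    intro l
    rw [tensorPow, inner_vecTensor, ← Finset.mul_prod_erase _ _ (Finset.mem_univ l),
      Finset.prod_congr rfl (g := fun _ => inner ℝ x u)]
    · simp [mul_comm]
    · intro j hj
      rw [Function.update_of_ne (Finset.ne_of_mem_erase hj)]
  simp [nu, inner_sum, h, mul_assoc]

/-- The tensor with `ν_{k_i}(y)` as its `i`-th factor and the powers `u_j^{⊗ k_j}` as the other
factors. -/
noncomputable def slotTensor {n : Fin d → ℕ} (k : Fin d → ℕ)
    (u : (i : Fin d) → EuclideanSpace ℝ (Fin (n i)))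
    (i : Fin d) (y : EuclideanSpace ℝ (Fin (n i))) : TensorSpace n k :=
  arrayTensor (Function.update (fun i => tensorPow (k i) (u i)) i (nu (k i) (u i) y))

theorem tangentTensor_eq {n : Fin d → ℕ} (k : Fin d → ℕ) (p v : FactorSpace n) :
    tangentTensor k p v = v.1 • segreVeroneseMap k (1, p.2) +
      p.1 • ∑ i, slotTensor k p.2 i (v.2 i) := by
  simp [tangentTensor, segreVeroneseMap, slotTensor]

theorem inner_segreVeroneseMap {n : Fin d → ℕ} (k : Fin d → ℕ) (p q : FactorSpace n) :
    inner ℝ (segreVeroneseMap k p) (segreVeroneseMap k q) =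
      p.1 * q.1 * ∏ i, inner ℝ (p.2 i) (q.2 i) ^ k i := by
  simp only [segreVeroneseMap, real_inner_smul_left, real_inner_smul_right, inner_arrayTensor,
    inner_tensorPow]
  ring

theorem inner_segreVeroneseMap_slotTensor {n : Fin d → ℕ} (k : Fin d → ℕ) (p : FactorSpace n)
    (u : (i : Fin d) → EuclideanSpace ℝ (Fin (n i))) (i : Fin d)
    (y : EuclideanSpace ℝ (Fin (n i))) :
    inner ℝ (segreVeroneseMap k p) (slotTensor k u i y) =
      p.1 * (k i * inner ℝ (p.2 i) (u i) ^ (k i - 1) *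
        ∏ j ∈ Finset.univ.erase i, inner ℝ (p.2 j) (u j) ^ k j) * inner ℝ (p.2 i) y := by
  rw [segreVeroneseMap, real_inner_smul_left, slotTensor, inner_arrayTensor,
    ← Finset.mul_prod_erase _ _ (Finset.mem_univ i), Function.update_self, inner_tensorPow_nu,
    Finset.prod_congr rfl (g := fun j => inner ℝ (p.2 j) (u j) ^ k j)]
  · ring
  · intro j hj
    rw [Function.update_of_ne (Finset.ne_of_mem_erase hj), inner_tensorPow]

theorem norm_segreVeroneseMap {n k : Fin d → ℕ} {p : FactorSpace n} (hp : p ∈ preSV n) :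
    ‖segreVeroneseMap k p‖ = p.1 := by
  have h := inner_segreVeroneseMap k p p
  simp only [real_inner_self_eq_norm_sq, hp.2, one_pow, Finset.prod_const_one, mul_one] at h
  nlinarith [hp.1, norm_nonneg (segreVeroneseMap k p)]

theorem hasDerivAt_tensorPow {n : ℕ} (m : ℕ) {c : ℝ → EuclideanSpace ℝ (Fin n)}
    {v : EuclideanSpace ℝ (Fin n)} {t : ℝ} (hc : HasDerivAt c v t) :
    HasDerivAt (fun s => tensorPow m (c s)) (nu m (c t) v) t := by
  rw [hasDerivAt_euclideanSpace]
  intro j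
  have h : ∀ l ∈ (Finset.univ : Finset (Fin m)),
      HasDerivAt (fun s => c s (j l)) (v (j l)) t := fun l _ => (hasDerivAt_euclideanSpace.1 hc) (j l)
  have := HasDerivAt.fun_finsetProd h
  refine this.congr_deriv ?_
  simp only [nu, WithLp.ofLp_sum, Finset.sum_apply]
  refine Finset.sum_congr rfl fun l _ => ?_
  simp only [vecTensor]
  rw [← Finset.mul_prod_erase _ _ (Finset.mem_univ l), Function.update_self, smul_eq_mul, mul_comm]
  congr 1
  refine Finset.prod_congr rfl fun j hj => ?_
  rw [Function.update_of_ne (Finset.ne_of_mem_erase hj)]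

theorem hasDerivAt_segreVeroneseMap {n : Fin d → ℕ} (k : Fin d → ℕ) {c : ℝ → FactorSpace n}
    {v : FactorSpace n} {t : ℝ} (hc : HasDerivAt c v t) :
    HasDerivAt (fun s => segreVeroneseMap k (c s)) (tangentTensor k (c t) v) t := by
  have h1 : HasDerivAt (fun s => (c s).1) v.1 t := hc.fst
  have h2 : ∀ i, HasDerivAt (fun s => (c s).2 i) (v.2 i) t := hasDerivAt_pi.1 hc.snd
  have h3 : HasDerivAt (fun s => (arrayTensor fun i => tensorPow (k i) ((c s).2 i) :
      TensorSpace n k)) (∑ i, slotTensor k (c t).2 i (v.2 i)) t := by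
    rw [hasDerivAt_euclideanSpace]
    intro j
    have h : ∀ i ∈ (Finset.univ : Finset (Fin d)),
        HasDerivAt (fun s => tensorPow (k i) ((c s).2 i) (j i))
          (nu (k i) ((c t).2 i) (v.2 i) (j i)) t :=
      fun i _ => (hasDerivAt_euclideanSpace.1 (hasDerivAt_tensorPow (k i) (h2 i))) (j i)
    refine (HasDerivAt.fun_finsetProd h).congr_deriv ?_
    simp only [WithLp.ofLp_sum, Finset.sum_apply]
    refine Finset.sum_congr rfl fun i _ => ?_
    simp only [slotTensor, arrayTensor]
    rw [← Finset.mul_prod_erase _ _ (Finset.mem_univ i), Function.update_self, smul_eq_mul,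
      mul_comm]
    congr 1
    refine Finset.prod_congr rfl fun j hj => ?_
    rw [Function.update_of_ne (Finset.ne_of_mem_erase hj)]
  refine (h1.smul h3).congr_deriv ?_
  rw [tangentTensor, add_comm]
  rfl

theorem contDiff_segreVeroneseMap {n : Fin d → ℕ} (k : Fin d → ℕ) :
    ContDiff ℝ ∞ (segreVeroneseMap k : FactorSpace n → TensorSpace n k) := by
  unfold segreVeroneseMap
  refine contDiff_fst.smul ?_
  rw [contDiff_piLp]
  intro j
  simp only [arrayTensor, tensorPow, vecTensor]
  refine contDiff_prod fun i _ => contDiff_prod fun l _ => ?_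
  exact (contDiff_piLp_apply 2).comp (contDiff_pi.1 contDiff_snd i)

/-! ### Curves -/

section Curves

variable {E : Type*} [NormedAddCommGroup E] [NormedSpace ℝ E]

theorem contDiffAt_of_contDiffOn_Ioo {γ : ℝ → E} {a b t : ℝ} (h : ContDiffOn ℝ ∞ γ (Ioo a b))
    (ht : t ∈ Ioo a b) : ContDiffAt ℝ ∞ γ t :=
  h.contDiffAt (Ioo_mem_nhds ht.1 ht.2)

theorem hasDerivAt_of_contDiffOn_Ioo {γ : ℝ → E} {a b t : ℝ} (h : ContDiffOn ℝ ∞ γ (Ioo a b))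
    (ht : t ∈ Ioo a b) : HasDerivAt γ (deriv γ t) t :=
  ((contDiffAt_of_contDiffOn_Ioo h ht).differentiableAt (by simp)).hasDerivAt

theorem contDiffOn_deriv_Ioo {γ : ℝ → E} {a b : ℝ} (h : ContDiffOn ℝ ∞ γ (Ioo a b)) :
    ContDiffOn ℝ ∞ (deriv γ) (Ioo a b) :=
  h.deriv_of_isOpen isOpen_Ioo (by simp)

theorem eq_of_hasDerivAt_zero {f : ℝ → E} {a b s t : ℝ} (h : ∀ x ∈ Ioo a b, HasDerivAt f 0 x)
    (hs : s ∈ Ioo a b) (ht : t ∈ Ioo a b) : f s = f t :=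
  isOpen_Ioo.is_const_of_deriv_eq_zero isPreconnected_Ioo
    (fun x hx => (h x hx).differentiableAt.differentiableWithinAt) (fun x hx => (h x hx).deriv) hs ht

end Curves

theorem hasDerivAt_radius {n : Fin d → ℕ} {c : ℝ → FactorSpace n} {v : FactorSpace n} {t : ℝ}
    (hc : HasDerivAt c v t) : HasDerivAt (fun s => (c s).1) v.1 t :=
  hc.fst

theorem hasDerivAt_direction {n : Fin d → ℕ} {c : ℝ → FactorSpace n} {v : FactorSpace n} {t : ℝ}
    (hc : HasDerivAt c v t) (i : Fin d) : HasDerivAt (fun s => (c s).2 i) (v.2 i) t :=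
  hasDerivAt_pi.1 hc.snd i

/-! ### The pre-Segre–Veronese manifold -/

/-- The hypothesis `hθ` covers `v = 0`, where `‖v‖⁻¹ • v` is `0` and not a unit vector. -/
theorem norm_cos_add_sin {V : Type*} [NormedAddCommGroup V] [InnerProductSpace ℝ V] {u v : V}
    (hu : ‖u‖ = 1) (huv : inner ℝ u v = 0) {θ : ℝ} (hθ : v = 0 → sin θ = 0) :
    ‖cos θ • u + sin θ • (‖v‖⁻¹ • v)‖ = 1 := by
  have h : ‖cos θ • u + sin θ • (‖v‖⁻¹ • v)‖ ^ 2 = 1 := by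
    rw [norm_add_sq_real]
    simp only [norm_smul, mul_pow, real_inner_smul_left, real_inner_smul_right, huv, hu,
      Real.norm_eq_abs, sq_abs]
    by_cases hv : v = 0
    · have := sin_sq_add_cos_sq θ
      simp only [hθ hv] at this ⊢
      linarith
    · have : ‖v‖ ≠ 0 := norm_ne_zero_iff.2 hv
      field_simp
      linear_combination ‖v‖ * sin_sq_add_cos_sq θ
  nlinarith [norm_nonneg (cos θ • u + sin θ • (‖v‖⁻¹ • v))]

theorem inner_eq_zero_of_norm_eq_one {V : Type*} [NormedAddCommGroup V] [InnerProductSpace ℝ V]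
    {w : ℝ → V} {v : V} {t : ℝ} (hw : HasDerivAt w v t) (h : ∀ᶠ s in nhds t, ‖w s‖ = 1) :
    inner ℝ (w t) v = 0 := by
  have h1 : HasDerivAt (fun s => inner ℝ (w s) (w s)) (0 : ℝ) t := by
    refine (hasDerivAt_const t (1 : ℝ)).congr_of_eventuallyEq ?_
    filter_upwards [h] with s hs
    rw [real_inner_self_eq_norm_sq, hs, one_pow]
  have h2 := (hw.inner ℝ hw).unique h1
  rw [real_inner_comm (w t) v] at h2
  linarith

theorem mem_tangentSpaceAt_preSV {n : Fin d → ℕ} {p v : FactorSpace n} (hp : p ∈ preSV n) :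
    v ∈ tangentSpaceAt (preSV n) p ↔ ∀ i, inner ℝ (p.2 i) (v.2 i) = 0 := by
  constructor
  · rintro ⟨ε, c, hε, -, hmem, rfl, hv⟩ i
    refine inner_eq_zero_of_norm_eq_one (w := fun s => (c s).2 i) (hasDerivAt_pi.1 hv.snd i) ?_
    filter_upwards [Ioo_mem_nhds (neg_lt_zero.2 hε) hε] with s hs
    exact (hmem s hs).2 i
  · intro h
    have hp1 : 0 < p.1 := hp.1
    -- The curve has affine radius and great circles as directions. The bound on `t` keeps the
    -- radius positive; the `+ 1` avoids division by zero.
    refine ⟨p.1 / (|v.1| + 1), fun t => (p.1 + t * v.1, fun i => cos (‖v.2 i‖ * t) • p.2 i +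
      sin (‖v.2 i‖ * t) • (‖v.2 i‖⁻¹ • v.2 i)), by positivity, ?_, ?_, ?_, ?_⟩
    · refine ContDiff.contDiffOn (ContDiff.prodMk (by fun_prop) (contDiff_pi.2 fun i => ?_))
      fun_prop
    · intro t ht
      refine ⟨?_, fun i => norm_cos_add_sin (hp.2 i) (h i) fun hv => by simp [hv]⟩
      have h1 : |t| * (|v.1| + 1) < p.1 := by
        rw [← lt_div_iff₀ (by positivity)]
        exact abs_lt.2 ht
      have h2 := neg_abs_le (t * v.1)
      rw [abs_mul] at h2
      change 0 < p.1 + t * v.1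
      nlinarith [abs_nonneg t]
    · ext <;> simp
    · refine HasDerivAt.prodMk ?_ (hasDerivAt_pi.2 fun i => ?_)
      · simpa using ((hasDerivAt_id (0 : ℝ)).mul_const v.1).const_add p.1
      · have hl : HasDerivAt (fun t : ℝ => ‖v.2 i‖ * t) ‖v.2 i‖ 0 := by
          simpa using (hasDerivAt_id (0 : ℝ)).const_mul ‖v.2 i‖
        refine ((hl.cos.smul_const (p.2 i)).add
          (hl.sin.smul_const (‖v.2 i‖⁻¹ • v.2 i))).congr_deriv ?_
        by_cases hv : v.2 i = 0
        · simp [hv]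
        · simp [smul_smul, norm_ne_zero_iff.2 hv]

/-- The metric depends on the base point only through the factor `(α r)²`, so every Christoffel term
comes from differentiating that factor. -/
theorem covariantAcceleration_preSVMetric (α : ℝ) (n k : Fin d → ℕ) (γ : ℝ → FactorSpace n) (t : ℝ)
    (y : FactorSpace n) :
    covariantAcceleration (preSVMetric α n k) γ t y =
      y.1 * ((deriv (deriv γ) t).1 -
        α ^ 2 * (γ t).1 * ∑ i, (k i : ℝ) * ‖(deriv γ t).2 i‖ ^ 2) +
      α ^ 2 * (2 * (γ t).1 * (deriv γ t).1 * ∑ i, (k i : ℝ) * inner ℝ ((deriv γ t).2 i) (y.2 i) +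
        (γ t).1 ^ 2 * ∑ i, (k i : ℝ) * inner ℝ ((deriv (deriv γ) t).2 i) (y.2 i)) := by
  have h : ∀ x u v w : FactorSpace n, fderiv ℝ (fun z => preSVMetric α n k z v w) x u =
      2 * α ^ 2 * x.1 * u.1 * ∑ i, (k i : ℝ) * inner ℝ (v.2 i) (w.2 i) := by
    intro x u v w
    have h1 : HasFDerivAt (fun z : FactorSpace n => z.1) (ContinuousLinearMap.fst ℝ _ _) x :=
      hasFDerivAt_fst
    have h2 := (((h1.const_mul α).pow 2).mul_const
      (∑ i, (k i : ℝ) * inner ℝ (v.2 i) (w.2 i))).const_add (inner ℝ v.1 w.1)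
    have h3 := h2.fderiv
    have h4 : (fun z => preSVMetric α n k z v w) = fun z => inner ℝ v.1 w.1 +
        ((α * z.1) ^ 2) * (∑ i, (k i : ℝ) * inner ℝ (v.2 i) (w.2 i)) := rfl
    rw [h4, h3]
    simp
    ring
  simp only [covariantAcceleration, christoffel, h]
  simp only [preSVMetric, warpedMetric, euclideanMetric, spheresMetric, RCLike.inner_apply,
    conj_trivial, real_inner_self_eq_norm_sq]
  ring

theorem inner_deriv_eq_zero {n : Fin d → ℕ} {a b : ℝ} {γ : ℝ → FactorSpace n}
    (hs : ContDiffOn ℝ ∞ γ (Ioo a b))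
    (hm : ∀ t ∈ Ioo a b, γ t ∈ preSV n) {t : ℝ} (ht : t ∈ Ioo a b) (i : Fin d) :
    inner ℝ ((γ t).2 i) ((deriv γ t).2 i) = 0 :=
  inner_eq_zero_of_norm_eq_one (w := fun s => (γ s).2 i)
    (hasDerivAt_direction (hasDerivAt_of_contDiffOn_Ioo hs ht) i)
    (Filter.mem_of_superset (Ioo_mem_nhds ht.1 ht.2) fun x hx => (hm x hx).2 i)

theorem inner_deriv_deriv_direction {n : Fin d → ℕ} {a b : ℝ} {γ : ℝ → FactorSpace n}
    (hs : ContDiffOn ℝ ∞ γ (Ioo a b))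
    (hm : ∀ t ∈ Ioo a b, γ t ∈ preSV n) {t : ℝ} (ht : t ∈ Ioo a b) (i : Fin d) :
    inner ℝ ((γ t).2 i) ((deriv (deriv γ) t).2 i) = -‖(deriv γ t).2 i‖ ^ 2 := by
  have h2 : HasDerivAt (fun s => inner ℝ ((γ s).2 i) ((deriv γ s).2 i)) (0 : ℝ) t :=
    (hasDerivAt_const t (0 : ℝ)).congr_of_eventuallyEq
      (Filter.mem_of_superset (Ioo_mem_nhds ht.1 ht.2) fun x hx => inner_deriv_eq_zero hs hm hx i)
  have h3 := ((hasDerivAt_direction (hasDerivAt_of_contDiffOn_Ioo hs ht) i).inner ℝ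
    (hasDerivAt_direction (hasDerivAt_of_contDiffOn_Ioo (contDiffOn_deriv_Ioo hs) ht) i)).unique h2
  rw [real_inner_self_eq_norm_sq] at h3
  linarith

/-- The geodesic equations of the pre-Segre–Veronese manifold. -/
theorem isGeodesicOn_preSV_iff {n k : Fin d → ℕ} (hk : ∀ i, 1 ≤ k i) {α : ℝ} (hα : 0 < α)
    {a b : ℝ} {γ : ℝ → FactorSpace n} (hs : ContDiffOn ℝ ∞ γ (Ioo a b))
    (hm : ∀ t ∈ Ioo a b, γ t ∈ preSV n) :
    IsGeodesicOn (preSV n) (preSVMetric α n k) (Ioo a b) γ ↔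
      ∀ t ∈ Ioo a b, (deriv (deriv γ) t).1 =
          α ^ 2 * (γ t).1 * ∑ i, (k i : ℝ) * ‖(deriv γ t).2 i‖ ^ 2 ∧
        ∀ i, (γ t).1 • (deriv (deriv γ) t).2 i + (2 * (deriv γ t).1) • (deriv γ t).2 i =
          (-((γ t).1 * ‖(deriv γ t).2 i‖ ^ 2)) • (γ t).2 i := by
  constructor
  · intro h t ht
    have hcov := fun w hw => h.acceleration_eq_zero t ht w
      ((mem_tangentSpaceAt_preSV (hm t ht)).2 hw)
    simp only [covariantAcceleration_preSVMetric] at hcov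
    refine ⟨?_, fun i => ?_⟩
    -- The purely radial test vector isolates the radial equation.
    · have := hcov (1, 0) (by simp)
      simp at this
      linarith
    · have h0 := inner_deriv_eq_zero hs hm ht i
      have h1 := inner_deriv_deriv_direction hs hm ht i
      set r := (γ t).1
      set w := (γ t).2 i
      set v := (deriv γ t).2 i
      set A := (deriv (deriv γ) t).2 i
      set c := (deriv γ t).1
      -- `η` is the defect of the direction equation. It is orthogonal to `w`, hence an admissible
      -- test vector, and testing the equation against it gives `α² r k_i ‖η‖² = 0`.
      set η := r • A + (2 * c) • v + (r * ‖v‖ ^ 2) • w with hη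
      have hr : 0 < r := (hm t ht).1
      have hw : ‖w‖ = 1 := (hm t ht).2 i
      have hwη : inner ℝ w η = 0 := by
        simp only [hη, inner_add_right, real_inner_smul_right, h1, h0,
          real_inner_self_eq_norm_sq, hw, w, v, A]
        ring
      have h4 := hcov (0, Pi.single i η) (by
        intro j
        by_cases hj : j = i
        · subst hj; simpa using hwη
        · simp [hj])
      have hsum : ∀ x : (j : Fin d) → EuclideanSpace ℝ (Fin (n j)),
          ∑ j, (k j : ℝ) * inner ℝ (x j)
            (Pi.single (M := fun j => EuclideanSpace ℝ (Fin (n j))) i η j) = k i * inner ℝ (x i) η := by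
        intro x
        rw [Finset.sum_eq_single i]
        · simp
        · intro j _ hj; simp [hj]
        · simp
      simp only [hsum, zero_mul, zero_add] at h4
      have hk0 : (0 : ℝ) < k i := by exact_mod_cast hk i
      have h5 : α ^ 2 * r * k i * inner ℝ η η = 0 := by
        nth_rewrite 1 [hη]
        simp only [inner_add_left, real_inner_smul_left, hwη]
        linear_combination h4
      have h6 : inner ℝ η η = 0 := by
        simpa [hα.ne', hr.ne', hk0.ne'] using h5
      rw [inner_self_eq_zero, hη] at h6
      rw [neg_smul]
      exact eq_neg_of_add_eq_zero_left h6
  · intro h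
    refine ⟨hs, hm, fun t ht y hy => ?_⟩
    rw [mem_tangentSpaceAt_preSV (hm t ht)] at hy
    obtain ⟨h1, h2⟩ := h t ht
    rw [covariantAcceleration_preSVMetric, h1]
    have h3 : 2 * (deriv γ t).1 * ∑ i, (k i : ℝ) * inner ℝ ((deriv γ t).2 i) (y.2 i) +
        (γ t).1 * ∑ i, (k i : ℝ) * inner ℝ ((deriv (deriv γ) t).2 i) (y.2 i) = 0 := by
      rw [Finset.mul_sum, Finset.mul_sum, ← Finset.sum_add_distrib]
      refine Finset.sum_eq_zero fun i _ => ?_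
      have h4 := congrArg (fun z => inner ℝ z (y.2 i)) (h2 i)
      simp only [inner_add_left, real_inner_smul_left, hy i] at h4
      linear_combination (k i : ℝ) * h4
    linear_combination α ^ 2 * (γ t).1 * h3

/-! ### Uniqueness of geodesics of the pre-Segre–Veronese manifold -/

section Uniqueness

variable {n k : Fin d → ℕ} {α a b : ℝ} {γ : ℝ → FactorSpace n}

theorem IsGeodesicOn.hasDerivAt {E : Type*} [NormedAddCommGroup E] [NormedSpace ℝ E] {M : Set E}
    {g : E → E → E → ℝ} {γ : ℝ → E} (h : IsGeodesicOn M g (Ioo a b) γ) {t : ℝ}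
    (ht : t ∈ Ioo a b) : HasDerivAt γ (deriv γ t) t :=
  hasDerivAt_of_contDiffOn_Ioo h.smooth ht

theorem IsGeodesicOn.hasDerivAt_deriv {E : Type*} [NormedAddCommGroup E] [NormedSpace ℝ E]
    {M : Set E} {g : E → E → E → ℝ} {γ : ℝ → E} (h : IsGeodesicOn M g (Ioo a b) γ) {t : ℝ}
    (ht : t ∈ Ioo a b) : HasDerivAt (deriv γ) (deriv (deriv γ) t) t :=
  hasDerivAt_of_contDiffOn_Ioo (contDiffOn_deriv_Ioo h.smooth) ht

/-- Conservation of angular momentum in each sphere. -/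
theorem IsGeodesicOn.momentum_eq (hk : ∀ i, 1 ≤ k i) (hα : 0 < α)
    (h : IsGeodesicOn (preSV n) (preSVMetric α n k) (Ioo a b) γ) {s t : ℝ}
    (hs : s ∈ Ioo a b) (ht : t ∈ Ioo a b) (i : Fin d) :
    (γ s).1 ^ 4 * ‖(deriv γ s).2 i‖ ^ 2 = (γ t).1 ^ 4 * ‖(deriv γ t).2 i‖ ^ 2 := by
  refine eq_of_hasDerivAt_zero (f := fun t => (γ t).1 ^ 4 * ‖(deriv γ t).2 i‖ ^ 2)
    (fun x hx => ?_) hs ht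
  have h1 := (hasDerivAt_radius (h.hasDerivAt hx))
  have h2 := hasDerivAt_direction (h.hasDerivAt_deriv hx) i
  have h3 := (h1.fun_pow 4).mul (h2.inner ℝ h2)
  simp only [real_inner_self_eq_norm_sq] at h3
  refine h3.congr_deriv ?_
  have h4 := ((isGeodesicOn_preSV_iff hk hα h.smooth h.mem).1 h x hx).2 i
  -- Pairing the direction equation with the velocity kills its normal side and leaves `r ⟨u', u''⟩
  -- = -2 r' ‖u'‖²`.
  have h5 := congrArg (fun z => inner ℝ ((deriv γ x).2 i) z) h4
  simp only [inner_add_right, real_inner_smul_right, real_inner_self_eq_norm_sq,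
    real_inner_comm ((γ x).2 i) ((deriv γ x).2 i), inner_deriv_eq_zero h.smooth h.mem hx i] at h5
  rw [real_inner_comm ((deriv γ x).2 i) ((deriv (deriv γ) x).2 i)]
  push_cast
  linear_combination 2 * (γ x).1 ^ 3 * h5

/-- Conservation of energy. -/
theorem IsGeodesicOn.energy_eq (hk : ∀ i, 1 ≤ k i) (hα : 0 < α)
    (h : IsGeodesicOn (preSV n) (preSVMetric α n k) (Ioo a b) γ) {s t : ℝ}
    (hs : s ∈ Ioo a b) (ht : t ∈ Ioo a b) :
    (deriv γ s).1 ^ 2 + α ^ 2 * (γ s).1 ^ 2 * ∑ i, (k i : ℝ) * ‖(deriv γ s).2 i‖ ^ 2 =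
      (deriv γ t).1 ^ 2 + α ^ 2 * (γ t).1 ^ 2 * ∑ i, (k i : ℝ) * ‖(deriv γ t).2 i‖ ^ 2 := by
  refine eq_of_hasDerivAt_zero (f := fun t => (deriv γ t).1 ^ 2 +
    α ^ 2 * (γ t).1 ^ 2 * ∑ i, (k i : ℝ) * ‖(deriv γ t).2 i‖ ^ 2) (fun x hx => ?_) hs ht
  have h1 := (hasDerivAt_radius (h.hasDerivAt hx))
  have h1' := (hasDerivAt_radius (h.hasDerivAt_deriv hx))
  have h2 := fun i => hasDerivAt_direction (h.hasDerivAt_deriv hx) i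
  have hsum := HasDerivAt.fun_sum (u := Finset.univ)
    fun i _ => ((h2 i).inner ℝ (h2 i)).const_mul (k i : ℝ)
  have h3 := (h1'.fun_pow 2).add (((h1.fun_pow 2).const_mul (α ^ 2)).mul hsum)
  simp only [real_inner_self_eq_norm_sq] at h3
  refine h3.congr_deriv ?_
  obtain ⟨h6, h4⟩ := (isGeodesicOn_preSV_iff hk hα h.smooth h.mem).1 h x hx
  have h5 : (γ x).1 * ∑ i, (k i : ℝ) * (inner ℝ ((deriv γ x).2 i) ((deriv (deriv γ) x).2 i) +
      inner ℝ ((deriv (deriv γ) x).2 i) ((deriv γ x).2 i)) =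
      -4 * (deriv γ x).1 * ∑ i, (k i : ℝ) * ‖(deriv γ x).2 i‖ ^ 2 := by
    rw [Finset.mul_sum, Finset.mul_sum]
    refine Finset.sum_congr rfl fun i _ => ?_
    have h5 := congrArg (fun z => inner ℝ ((deriv γ x).2 i) z) (h4 i)
    simp only [inner_add_right, real_inner_smul_right, real_inner_self_eq_norm_sq,
      real_inner_comm ((γ x).2 i) ((deriv γ x).2 i), inner_deriv_eq_zero h.smooth h.mem hx i] at h5
    rw [real_inner_comm ((deriv γ x).2 i) ((deriv (deriv γ) x).2 i)]
    linear_combination 2 * (k i : ℝ) * h5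
  rw [h6]
  push_cast
  linear_combination α ^ 2 * (γ x).1 * h5

/-- The square of the radius is a quadratic polynomial along a geodesic. -/
theorem IsGeodesicOn.sq_radius_eq (hk : ∀ i, 1 ≤ k i) (hα : 0 < α)
    (h : IsGeodesicOn (preSV n) (preSVMetric α n k) (Ioo a b) γ) {s t : ℝ}
    (hs : s ∈ Ioo a b) (ht : t ∈ Ioo a b) :
    (γ t).1 ^ 2 = ((γ s).1 + (t - s) * (deriv γ s).1) ^ 2 +
      α ^ 2 * ((t - s) * (γ s).1) ^ 2 * ∑ i, (k i : ℝ) * ‖(deriv γ s).2 i‖ ^ 2 := by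
  -- By the radial equation, `(r r')' = r'² + r r''` is the conserved energy `E`; two integrations
  -- give the quadratic.
  set E := (deriv γ s).1 ^ 2 + α ^ 2 * (γ s).1 ^ 2 * ∑ i, (k i : ℝ) * ‖(deriv γ s).2 i‖ ^ 2 with hE
  have h1 : ∀ x ∈ Ioo a b, (γ x).1 * (deriv γ x).1 - (x - s) * E = (γ s).1 * (deriv γ s).1 := by
    intro x hx
    have := eq_of_hasDerivAt_zero (f := fun x => (γ x).1 * (deriv γ x).1 - (x - s) * E)
      (fun y hy => ?_) hx hs
    · simpa using this
    · refine (((hasDerivAt_radius (h.hasDerivAt hy)).mul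
        (hasDerivAt_radius (h.hasDerivAt_deriv hy))).sub
        (((hasDerivAt_id y).sub_const s).mul_const E)).congr_deriv ?_
      rw [((isGeodesicOn_preSV_iff hk hα h.smooth h.mem).1 h y hy).1, hE,
        ← h.energy_eq hk hα hy hs]
      ring
  have h2 := eq_of_hasDerivAt_zero (f := fun x => (γ x).1 ^ 2 -
      ((x - s) ^ 2 * E + 2 * (x - s) * ((γ s).1 * (deriv γ s).1))) (fun y hy => ?_) ht hs
  · simp only [sub_self] at h2
    linear_combination h2
  · have hl := (hasDerivAt_id y).sub_const s
    refine (((hasDerivAt_radius (h.hasDerivAt hy)).fun_pow 2).sub (((hl.fun_pow 2).mul_const E).add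
      ((hl.const_mul 2).mul_const ((γ s).1 * (deriv γ s).1)))).congr_deriv ?_
    simp only [id, ← h1 y hy]
    push_cast
    ring

/-- The squared radii are the same quadratic, so the radii agree. In the parameter `τ` with `dτ = dt
/ r²`, each direction satisfies the oscillator equation `u'' = -C u`, with `C` the conserved squared
momentum, common to both curves. The difference `w` satisfies it too, so its oscillator energy, in
the original time `r⁴ ‖w'‖² + C ‖w‖²`, is constant. It vanishes at `s`, which forces `w' = 0`
throughout. -/
theorem IsGeodesicOn.eqOn (hk : ∀ i, 1 ≤ k i) (hα : 0 < α) {γ₁ γ₂ : ℝ → FactorSpace n}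
    (h₁ : IsGeodesicOn (preSV n) (preSVMetric α n k) (Ioo a b) γ₁)
    (h₂ : IsGeodesicOn (preSV n) (preSVMetric α n k) (Ioo a b) γ₂) {s : ℝ} (hs : s ∈ Ioo a b)
    (h : γ₁ s = γ₂ s) (h' : deriv γ₁ s = deriv γ₂ s) : EqOn γ₁ γ₂ (Ioo a b) := by
  have hr : ∀ t ∈ Ioo a b, (γ₁ t).1 = (γ₂ t).1 := by
    intro t ht
    have h1 := h₁.sq_radius_eq hk hα hs ht
    rw [h, h', ← h₂.sq_radius_eq hk hα hs ht] at h1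
    exact (pow_left_inj₀ (h₁.mem t ht).1.le (h₂.mem t ht).1.le two_ne_zero).1 h1
  have hr' : ∀ t ∈ Ioo a b, (deriv γ₁ t).1 = (deriv γ₂ t).1 := by
    intro t ht
    refine (hasDerivAt_radius (h₁.hasDerivAt ht)).unique
      ((hasDerivAt_radius (h₂.hasDerivAt ht)).congr_of_eventuallyEq ?_)
    exact Filter.mem_of_superset (Ioo_mem_nhds ht.1 ht.2) hr
  intro t ht
  refine Prod.ext (hr t ht) (funext fun i => ?_)
  set C := (γ₁ s).1 ^ 4 * ‖(deriv γ₁ s).2 i‖ ^ 2 with hC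
  have hC₁ : ∀ x ∈ Ioo a b, (γ₁ x).1 ^ 4 * ‖(deriv γ₁ x).2 i‖ ^ 2 = C :=
    fun x hx => h₁.momentum_eq hk hα hx hs i
  have hC₂ : ∀ x ∈ Ioo a b, (γ₁ x).1 ^ 4 * ‖(deriv γ₂ x).2 i‖ ^ 2 = C := by
    intro x hx
    rw [hr x hx, h₂.momentum_eq hk hα hx hs i, hC, h, h']
  set w : ℝ → EuclideanSpace ℝ (Fin (n i)) := fun x => (γ₁ x).2 i - (γ₂ x).2 i with hw
  set v : ℝ → EuclideanSpace ℝ (Fin (n i)) := fun x => (deriv γ₁ x).2 i - (deriv γ₂ x).2 i with hv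
  have hw' : ∀ x ∈ Ioo a b, HasDerivAt w (v x) x := fun x hx =>
    (hasDerivAt_direction (h₁.hasDerivAt hx) i).sub (hasDerivAt_direction (h₂.hasDerivAt hx) i)
  have hQ : ∀ x ∈ Ioo a b, (γ₁ x).1 ^ 4 * inner ℝ (v x) (v x) + C * inner ℝ (w x) (w x) = 0 := by
    intro x hx
    have := eq_of_hasDerivAt_zero
      (f := fun x => (γ₁ x).1 ^ 4 * inner ℝ (v x) (v x) + C * inner ℝ (w x) (w x))
      (fun y hy => ?_) hx hs
    · rw [this]
      simp [hv, hw, h, h']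
    · have hv' : HasDerivAt v ((deriv (deriv γ₁) y).2 i - (deriv (deriv γ₂) y).2 i) y :=
        (hasDerivAt_direction (h₁.hasDerivAt_deriv hy) i).sub
          (hasDerivAt_direction (h₂.hasDerivAt_deriv hy) i)
      refine ((((hasDerivAt_radius (h₁.hasDerivAt hy)).fun_pow 4).mul (hv'.inner ℝ hv')).add
        (((hw' y hy).inner ℝ (hw' y hy)).const_mul C)).congr_deriv ?_
      have e₁ := ((isGeodesicOn_preSV_iff hk hα h₁.smooth h₁.mem).1 h₁ y hy).2 i
      have e₂ := ((isGeodesicOn_preSV_iff hk hα h₂.smooth h₂.mem).1 h₂ y hy).2 i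
      rw [← hr y hy, ← hr' y hy] at e₂
      have f₁ := congrArg (fun z => inner ℝ (v y) z) e₁
      have f₂ := congrArg (fun z => inner ℝ (v y) z) e₂
      simp only [inner_add_right, real_inner_smul_right] at f₁ f₂
      have hvv : inner ℝ (v y) (v y) = inner ℝ (v y) ((deriv γ₁ y).2 i) -
        inner ℝ (v y) ((deriv γ₂ y).2 i) := by rw [← inner_sub_right]
      have hvw : inner ℝ (v y) (w y) = inner ℝ (v y) ((γ₁ y).2 i) -
        inner ℝ (v y) ((γ₂ y).2 i) := by rw [← inner_sub_right]
      have hva := inner_sub_right (𝕜 := ℝ) (v y) ((deriv (deriv γ₁) y).2 i)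
        ((deriv (deriv γ₂) y).2 i)
      rw [real_inner_comm (v y) ((deriv (deriv γ₁) y).2 i - (deriv (deriv γ₂) y).2 i),
        real_inner_comm (v y) (w y), hva, hvv, hvw]
      -- The normal terms of the two direction equations carry `r⁴ ‖u'‖²`; both are replaced by the
      -- common `C`.
      have c₁ := hC₁ y hy
      have c₂ := hC₂ y hy
      push_cast
      linear_combination 2 * (γ₁ y).1 ^ 3 * (f₁ - f₂)
        - 2 * inner ℝ (v y) ((γ₁ y).2 i) * c₁ + 2 * inner ℝ (v y) ((γ₂ y).2 i) * c₂
  have hv0 : ∀ x ∈ Ioo a b, v x = 0 := by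
    intro x hx
    have h1 := hQ x hx
    have h2 : 0 < (γ₁ x).1 := (h₁.mem x hx).1
    have h3 : 0 ≤ C * inner ℝ (w x) (w x) := mul_nonneg (by positivity) real_inner_self_nonneg
    have h4 : 0 ≤ inner ℝ (v x) (v x) := real_inner_self_nonneg
    have h5 : (γ₁ x).1 ^ 4 * inner ℝ (v x) (v x) = 0 := by nlinarith [pow_pos h2 4]
    rcases mul_eq_zero.1 h5 with h6 | h6
    · exact absurd h6 (pow_pos h2 4).ne'
    · exact inner_self_eq_zero.1 h6
  have h6 := eq_of_hasDerivAt_zero (f := w) (fun x hx => hv0 x hx ▸ hw' x hx) ht hs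
  simp only [hw, h, sub_self] at h6
  exact sub_eq_zero.1 h6

end Uniqueness

/-! ### The geodesics of the pre-Segre–Veronese manifold -/

/-- The curve `z(t) = (r + t r') + i t r α N` in the complex plane; its modulus is the radius of the
geodesic of the pre-Segre–Veronese manifold, and its argument is proportional to the angles. -/
noncomputable def unrolledCurve {n : Fin d → ℕ} (α : ℝ) (k : Fin d → ℕ) (p v : FactorSpace n)
    (t : ℝ) : ℂ :=
  ⟨p.1 + t * v.1, t * (p.1 * α * sphericalSpeed k v)⟩

/-- The ratio of the `i`-th angle to the argument of `unrolledCurve`. -/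
noncomputable def angularRatio {n : Fin d → ℕ} (α : ℝ) (k : Fin d → ℕ) (v : FactorSpace n)
    (i : Fin d) : ℝ :=
  ‖v.2 i‖ / (α * sphericalSpeed k v)

/-- The geodesic of the pre-Segre–Veronese manifold that starts at `p` with velocity `v`. -/
noncomputable def preSVGeodesic {n : Fin d → ℕ} (α : ℝ) (k : Fin d → ℕ) (p v : FactorSpace n)
    (t : ℝ) : FactorSpace n :=
  (‖unrolledCurve α k p v t‖, fun i =>
    cos (angularRatio α k v i * Complex.arg (unrolledCurve α k p v t)) • p.2 i +
      sin (angularRatio α k v i * Complex.arg (unrolledCurve α k p v t)) • (‖v.2 i‖⁻¹ • v.2 i))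

section Explicit

variable {n k : Fin d → ℕ} {α : ℝ} {p v : FactorSpace n}

theorem sphericalSpeed_nonneg : 0 ≤ sphericalSpeed k v := sqrt_nonneg _

theorem sq_sphericalSpeed : sphericalSpeed k v ^ 2 = ∑ i, (k i : ℝ) * ‖v.2 i‖ ^ 2 :=
  sq_sqrt (Finset.sum_nonneg fun _ _ => by positivity)

theorem sphericalSpeed_eq_zero_iff (hk : ∀ i, 1 ≤ k i) : sphericalSpeed k v = 0 ↔ v.2 = 0 := by
  rw [← sq_eq_zero_iff, sq_sphericalSpeed,
    Finset.sum_eq_zero_iff_of_nonneg fun _ _ => by positivity, funext_iff]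
  refine forall_congr' fun i => ?_
  have : (k i : ℝ) ≠ 0 := by exact_mod_cast (Nat.one_le_iff_ne_zero.1 (hk i))
  simp [this]

theorem hasDerivAt_unrolledCurve (t : ℝ) :
    HasDerivAt (unrolledCurve α k p v) ⟨v.1, p.1 * α * sphericalSpeed k v⟩ t := by
  have h1 : HasDerivAt (fun t : ℝ => ((p.1 + t * v.1 : ℝ) : ℂ)) (v.1 : ℂ) t := by
    simpa using (((hasDerivAt_id t).mul_const v.1).const_add p.1).ofReal_comp
  have h2 : HasDerivAt (fun t : ℝ => ((t * (p.1 * α * sphericalSpeed k v) : ℝ) : ℂ) * Complex.I)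
      ((p.1 * α * sphericalSpeed k v : ℝ) * Complex.I) t := by
    simpa using ((hasDerivAt_id t).mul_const (p.1 * α * sphericalSpeed k v)).ofReal_comp.mul_const
      Complex.I
  refine ((h1.add h2).congr_deriv (Complex.mk_eq_add_mul_I _ _).symm).congr_of_eventuallyEq
    (.of_forall fun t => Complex.mk_eq_add_mul_I _ _)

theorem contDiff_unrolledCurve : ContDiff ℝ ∞ (unrolledCurve α k p v) := by
  have : unrolledCurve α k p v = fun t : ℝ => (p.1 : ℂ) + t * (v.1 : ℂ) +
      t * (p.1 * α * sphericalSpeed k v) * Complex.I := by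
    ext t
    rw [unrolledCurve, Complex.mk_eq_add_mul_I]
    push_cast
    ring
  rw [this]
  have h : ContDiff ℝ ∞ (fun t : ℝ => (t : ℂ)) := Complex.ofRealCLM.contDiff
  fun_prop

theorem contDiffAt_arg_unrolledCurve {t : ℝ} (h : unrolledCurve α k p v t ∈ Complex.slitPlane) :
    ContDiffAt ℝ ∞ (fun t => Complex.arg (unrolledCurve α k p v t)) t := by
  have h1 : ContDiffAt ℝ ∞ (fun t => Complex.log (unrolledCurve α k p v t)) t :=
    ((Complex.contDiffAt_log h).restrict_scalars ℝ).comp t contDiff_unrolledCurve.contDiffAt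
  have h2 := Complex.imCLM.contDiff.contDiffAt.comp t h1
  simpa [Function.comp_def, Complex.log_im] using h2

/-- The derivative is `Im (z' / z)`. Its numerator, twice the rate at which `z` sweeps area, is
constant because `z` moves on a straight line at constant velocity. -/
theorem hasDerivAt_arg_unrolledCurve {t : ℝ} (h : unrolledCurve α k p v t ∈ Complex.slitPlane) :
    HasDerivAt (fun t => Complex.arg (unrolledCurve α k p v t))
      (p.1 ^ 2 * α * sphericalSpeed k v / ‖unrolledCurve α k p v t‖ ^ 2) t := by
  have h1 := Complex.imCLM.hasFDerivAt.comp_hasDerivAt t ((hasDerivAt_unrolledCurve t).clog_real h)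
  simp only [Function.comp_def, Complex.imCLM_apply, Complex.log_im] at h1
  refine h1.congr_deriv ?_
  rw [Complex.div_im, Complex.normSq_eq_norm_sq]
  simp only [unrolledCurve]
  ring

theorem hasDerivAt_norm_unrolledCurve {t : ℝ} (h : unrolledCurve α k p v t ≠ 0) :
    HasDerivAt (fun t => ‖unrolledCurve α k p v t‖)
      (((p.1 + t * v.1) * v.1 + t * (p.1 * α * sphericalSpeed k v) ^ 2) /
        ‖unrolledCurve α k p v t‖) t := by
  have h0 : ‖unrolledCurve α k p v t‖ ≠ 0 := norm_ne_zero_iff.2 h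
  have h1 : ∀ t, ‖unrolledCurve α k p v t‖ =
      √((p.1 + t * v.1) ^ 2 + (t * (p.1 * α * sphericalSpeed k v)) ^ 2) := by
    intro t
    rw [Complex.norm_eq_sqrt_sq_add_sq]
    rfl
  have h2 : HasDerivAt (fun t : ℝ => (p.1 + t * v.1) ^ 2 +
      (t * (p.1 * α * sphericalSpeed k v)) ^ 2)
      (2 * ((p.1 + t * v.1) * v.1 + t * (p.1 * α * sphericalSpeed k v) ^ 2)) t := by
    have h3 := (((hasDerivAt_id t).mul_const v.1).const_add p.1).fun_pow 2
    have h4 := ((hasDerivAt_id t).mul_const (p.1 * α * sphericalSpeed k v)).fun_pow 2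
    refine (h3.add h4).congr_deriv ?_
    simp only [id]
    push_cast
    ring
  have h5 := h2.sqrt (fun h6 => h0 (by rw [h1, h6, sqrt_zero]))
  simp only [← h1] at h5
  refine h5.congr_deriv ?_
  field_simp

/-- In polar coordinates `z'' = 0` reads `R'' = R φ'²` and `R φ'' + 2 R' φ' = 0`. The second is the
tangential part of every direction equation, since the angles are `β_i φ`. The first is the radial
equation because `∑ k_i β_i² = 1 / α²` when `N ≠ 0`. -/
theorem isGeodesicOn_preSVGeodesic (hk : ∀ i, 1 ≤ k i) (hα : 0 < α) (hp : p ∈ preSV n)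
    (hv : ∀ i, inner ℝ (p.2 i) (v.2 i) = 0) {a b : ℝ}
    (hab : ∀ t ∈ Ioo a b, unrolledCurve α k p v t ∈ Complex.slitPlane) :
    IsGeodesicOn (preSV n) (preSVMetric α n k) (Ioo a b) (preSVGeodesic α k p v) := by
  set N := sphericalSpeed k v with hN
  have hb0 : ∀ i, v.2 i = 0 → angularRatio α k v i = 0 := fun i h => by simp [angularRatio, h]
  have hne : ∀ t ∈ Ioo a b, unrolledCurve α k p v t ≠ 0 := fun t ht =>
    Complex.slitPlane_ne_zero (hab t ht)
  have hs : ContDiffOn ℝ ∞ (preSVGeodesic α k p v) (Ioo a b) := by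
    intro t ht
    refine ContDiffAt.contDiffWithinAt (ContDiffAt.prodMk ?_ (contDiffAt_pi.2 fun i => ?_))
    · exact contDiff_unrolledCurve.contDiffAt.norm ℝ (hne t ht)
    · have := contDiffAt_arg_unrolledCurve (hab t ht)
      exact (((contDiffAt_const.mul this).cos).smul contDiffAt_const).add
        (((contDiffAt_const.mul this).sin).smul contDiffAt_const)
  have hm : ∀ t ∈ Ioo a b, preSVGeodesic α k p v t ∈ preSV n := fun t ht =>
    ⟨norm_pos_iff.2 (hne t ht), fun i => norm_cos_add_sin (hp.2 i) (hv i)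
      fun h => by simp [hb0 i h]⟩
  set R : ℝ → ℝ := fun t => ‖unrolledCurve α k p v t‖ with hR
  set φ : ℝ → ℝ := fun t => Complex.arg (unrolledCurve α k p v t) with hφ
  set R' : ℝ → ℝ := fun t => ((p.1 + t * v.1) * v.1 + t * (p.1 * α * N) ^ 2) / R t with hR'
  set φ' : ℝ → ℝ := fun t => p.1 ^ 2 * α * N / R t ^ 2 with hφ'
  set β := angularRatio α k v with hβ
  set e : (i : Fin d) → EuclideanSpace ℝ (Fin (n i)) := fun i => ‖v.2 i‖⁻¹ • v.2 i with he
  have dR : ∀ t ∈ Ioo a b, HasDerivAt R (R' t) t := fun t ht =>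
    hasDerivAt_norm_unrolledCurve (hne t ht)
  have dφ : ∀ t ∈ Ioo a b, HasDerivAt φ (φ' t) t := fun t ht =>
    hasDerivAt_arg_unrolledCurve (hab t ht)
  have hR0 : ∀ t ∈ Ioo a b, R t ≠ 0 := fun t ht => norm_ne_zero_iff.2 (hne t ht)
  have hRsq : ∀ t, R t ^ 2 = (p.1 + t * v.1) ^ 2 + (t * (p.1 * α * N)) ^ 2 := fun t => by
    simp only [hR]
    rw [Complex.sq_norm, Complex.normSq_apply]
    simp only [unrolledCurve]
    ring
  have hd : ∀ t ∈ Ioo a b, HasDerivAt (preSVGeodesic α k p v)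
      (R' t, fun i => (β i * φ' t) • (-sin (β i * φ t) • p.2 i + cos (β i * φ t) • e i)) t := by
    intro t ht
    refine HasDerivAt.prodMk (dR t ht) (hasDerivAt_pi.2 fun i => ?_)
    have hl := (dφ t ht).const_mul (β i)
    refine ((hl.cos.smul_const (p.2 i)).add (hl.sin.smul_const (e i))).congr_deriv ?_
    module
  have hd' : ∀ t ∈ Ioo a b, deriv (preSVGeodesic α k p v) t =
      (R' t, fun i => (β i * φ' t) • (-sin (β i * φ t) • p.2 i + cos (β i * φ t) • e i)) :=
    fun t ht => (hd t ht).deriv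
  have hdd : ∀ t ∈ Ioo a b, HasDerivAt (deriv (preSVGeodesic α k p v))
      (R t * φ' t ^ 2, fun i =>
        (β i * (-2 * φ' t * R' t / R t)) • (-sin (β i * φ t) • p.2 i + cos (β i * φ t) • e i) +
        (-(β i * φ' t) ^ 2) • (cos (β i * φ t) • p.2 i + sin (β i * φ t) • e i)) t := by
    intro t ht
    have h0 := hR0 t ht
    refine HasDerivAt.congr_of_eventuallyEq ?_
      (Filter.mem_of_superset (Ioo_mem_nhds ht.1 ht.2) hd')
    refine HasDerivAt.prodMk ?_ (hasDerivAt_pi.2 fun i => ?_)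
    · have h1 := (((hasDerivAt_id t).mul_const v.1).const_add p.1).mul_const v.1
      have h2 := (hasDerivAt_id t).mul_const ((p.1 * α * N) ^ 2)
      refine ((h1.add h2).div (dR t ht) h0).congr_deriv ?_
      have h3 := hRsq t
      simp only [hR', hφ', id, Pi.add_apply]
      field_simp
      rw [h3]
      ring
    · have hl := (dφ t ht).const_mul (β i)
      have h1 : HasDerivAt φ' (-2 * φ' t * R' t / R t) t := by
        refine ((hasDerivAt_const t (p.1 ^ 2 * α * N)).div ((dR t ht).fun_pow 2)
          (pow_ne_zero 2 h0)).congr_deriv ?_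
        simp only [hφ']
        field_simp
        push_cast
        ring
      refine ((h1.const_mul (β i)).smul ((hl.sin.neg.smul_const (p.2 i)).add
        (hl.cos.smul_const (e i)))).congr_deriv ?_
      simp only [Pi.add_apply, Pi.neg_apply]
      module
  refine (isGeodesicOn_preSV_iff hk hα hs hm).2 fun t ht => ?_
  have h0 := hR0 t ht
  rw [(hdd t ht).deriv, hd' t ht]
  have hnorm : ∀ i, ‖(β i * φ' t) • (-sin (β i * φ t) • p.2 i + cos (β i * φ t) • e i)‖ ^ 2 =
      β i ^ 2 * φ' t ^ 2 := by
    intro i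
    rw [norm_smul, mul_pow, norm_eq_abs, sq_abs]
    by_cases h : v.2 i = 0
    · simp [hb0 i h]
    -- The unit tangent of the great circle is its point a quarter turn later.
    · have := norm_cos_add_sin (hp.2 i) (hv i) (θ := β i * φ t + π / 2) (fun h' => absurd h' h)
      rw [cos_add_pi_div_two, sin_add_pi_div_two] at this
      rw [this]
      ring
  refine ⟨?_, fun i => ?_⟩
  · simp only [hnorm]
    change R t * φ' t ^ 2 = α ^ 2 * R t * ∑ i, (k i : ℝ) * (β i ^ 2 * φ' t ^ 2)
    have h1 : ∑ i, (k i : ℝ) * (β i ^ 2 * φ' t ^ 2) =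
        (∑ i, (k i : ℝ) * ‖v.2 i‖ ^ 2) * (φ' t ^ 2 / (α * N) ^ 2) := by
      rw [Finset.sum_mul]
      refine Finset.sum_congr rfl fun i _ => ?_
      simp only [hβ, angularRatio, ← hN]
      ring
    rw [h1, ← sq_sphericalSpeed, ← hN]
    -- For `N = 0` the sum of the `k_i β_i²` is not `1 / α²`, but then `φ'` vanishes.
    by_cases h : N = 0
    · simp [hφ', h]
    · field_simp
  · simp only [hnorm]
    change R t • ((β i * (-2 * φ' t * R' t / R t)) •
        (-sin (β i * φ t) • p.2 i + cos (β i * φ t) • e i) +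
        (-(β i * φ' t) ^ 2) • (cos (β i * φ t) • p.2 i + sin (β i * φ t) • e i)) +
      (2 * R' t) • ((β i * φ' t) • (-sin (β i * φ t) • p.2 i + cos (β i * φ t) • e i)) =
      (-(R t * (β i ^ 2 * φ' t ^ 2))) • (cos (β i * φ t) • p.2 i + sin (β i * φ t) • e i)
    have h1 : R t * (β i * (-2 * φ' t * R' t / R t)) = -(2 * R' t * (β i * φ' t)) := by
      field_simp
    rw [smul_add, smul_smul, h1]
    module

theorem preSVGeodesic_zero (hp : p ∈ preSV n) : preSVGeodesic α k p v 0 = p := by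
  have h1 : unrolledCurve α k p v 0 = (p.1 : ℂ) := by simp [unrolledCurve, Complex.ext_iff]
  have h2 : 0 < p.1 := hp.1
  ext
  · simp [preSVGeodesic, h1, abs_of_pos h2]
  · simp [preSVGeodesic, h1, Complex.arg_ofReal_of_nonneg h2.le]

theorem deriv_preSVGeodesic_zero (hk : ∀ i, 1 ≤ k i) (hα : 0 < α) (hp : p ∈ preSV n) :
    deriv (preSVGeodesic α k p v) 0 = v := by
  have h2 : 0 < p.1 := hp.1
  have h1 : unrolledCurve α k p v 0 = (p.1 : ℂ) := by simp [unrolledCurve, Complex.ext_iff]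
  have hs : unrolledCurve α k p v 0 ∈ Complex.slitPlane := by
    rw [h1, Complex.ofReal_mem_slitPlane]
    exact h2
  have dR := hasDerivAt_norm_unrolledCurve (Complex.slitPlane_ne_zero hs)
  have dφ := hasDerivAt_arg_unrolledCurve hs
  refine HasDerivAt.deriv (HasDerivAt.prodMk (f₁' := v.1) (f₂' := v.2) (dR.congr_deriv ?_)
    (hasDerivAt_pi.2 fun i => ?_))
  · simp [h1, abs_of_pos h2, h2.ne']
  · have hl := dφ.const_mul (angularRatio α k v i)
    refine ((hl.cos.smul_const (p.2 i)).add
      (hl.sin.smul_const (‖v.2 i‖⁻¹ • v.2 i))).congr_deriv ?_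
    simp only [h1, Complex.arg_ofReal_of_nonneg h2.le, mul_zero, sin_zero, cos_zero, neg_zero,
      zero_mul, zero_smul, zero_add, one_mul, Complex.norm_real, norm_eq_abs, abs_of_pos h2,
      smul_smul, angularRatio]
    by_cases h : v.2 i = 0
    · simp [h]
    · have h3 : ‖v.2 i‖ ≠ 0 := norm_ne_zero_iff.2 h
      have h4 : sphericalSpeed k v ≠ 0 := fun h5 =>
        h (congrFun ((sphericalSpeed_eq_zero_iff hk).1 h5) i)
      -- At time `0` the argument grows at rate `α N`, so the `i`-th angle grows at rate `‖v.2 i‖`.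
      have : ‖v.2 i‖ / (α * sphericalSpeed k v) *
          (p.1 ^ 2 * α * sphericalSpeed k v / p.1 ^ 2) * ‖v.2 i‖⁻¹ = 1 := by
        field_simp
      rw [this, one_smul]

theorem preSVGeodesic_one (hk : ∀ i, 1 ≤ k i) (hα : 0 < α) (hp : p ∈ preSV n)
    (hv : ¬ (v.2 = 0 ∧ v.1 ≤ -p.1)) : preSVGeodesic α k p v 1 = preSVExpFormula α k p v := by
  have hp0 : 0 < p.1 := hp.1
  by_cases h : sphericalSpeed k v = 0
  · rw [preSVExpFormula, if_pos h]
    have hv0 := (sphericalSpeed_eq_zero_iff hk).1 h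
    have h2 : 0 < p.1 + v.1 := by
      by_contra h3
      exact hv ⟨hv0, by linarith⟩
    have h1 : unrolledCurve α k p v 1 = ((p.1 + v.1 : ℝ) : ℂ) := by
      simp [unrolledCurve, Complex.ext_iff, h]
    ext
    · simp only [preSVGeodesic, h1, Complex.norm_real, norm_eq_abs, abs_of_pos h2]
    · simp [preSVGeodesic, h1, Complex.arg_ofReal_of_nonneg h2.le, -Complex.ofReal_add]
  · rw [preSVExpFormula, if_neg h]
    have hN : 0 < sphericalSpeed k v := lt_of_le_of_ne sphericalSpeed_nonneg (Ne.symm h)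
    have hY : 0 < p.1 * α * sphericalSpeed k v := by positivity
    -- Since `Im z(1) > 0`, the argument lies in `(0, π)`. The complement of the arctangent of `Re /
    -- Im` gives it for either sign of the real part.
    have harg : Complex.arg (unrolledCurve α k p v 1) =
        π / 2 - arctan ((p.1 + v.1) / (p.1 * α * sphericalSpeed k v)) := by
      set X := p.1 + v.1 with hX
      set Y := p.1 * α * sphericalSpeed k v with hYd
      have h1 : unrolledCurve α k p v 1 = ((Y * √(1 + (X / Y) ^ 2) : ℝ) : ℂ) *
          (Complex.cos ((π / 2 - arctan (X / Y) : ℝ) : ℂ) +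
            Complex.sin ((π / 2 - arctan (X / Y) : ℝ) : ℂ) * Complex.I) := by
        rw [← Complex.ofReal_cos, ← Complex.ofReal_sin, cos_pi_div_two_sub, sin_pi_div_two_sub,
          sin_arctan, cos_arctan]
        have h3 : √(1 + (X / Y) ^ 2) ≠ 0 := by positivity
        have h4 : Y * √(1 + (X / Y) ^ 2) * (X / Y / √(1 + (X / Y) ^ 2)) = X := by
          field_simp
        have h5 : Y * √(1 + (X / Y) ^ 2) * (1 / √(1 + (X / Y) ^ 2)) = Y := by
          field_simp
        rw [mul_add, ← mul_assoc, ← Complex.ofReal_mul, ← Complex.ofReal_mul, h4, h5,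
          ← Complex.mk_eq_add_mul_I, unrolledCurve]
        simp [hX, hYd]
      rw [h1]
      refine Complex.arg_mul_cos_add_sin_mul_I (by positivity) ⟨?_, ?_⟩
      · linarith [arctan_lt_pi_div_two (X / Y), pi_pos]
      · linarith [neg_pi_div_two_lt_arctan (X / Y)]
    refine Prod.ext ?_ (funext fun i => ?_)
    · simp only [preSVGeodesic]
      rw [Complex.norm_eq_sqrt_sq_add_sq]
      simp [unrolledCurve]
    · simp only [preSVGeodesic, harg, angularRatio, expAngle]

end Explicit

/-! ### The warped metric of the tensor space -/

section AlphaMetric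

variable {V : Type*} [NormedAddCommGroup V] [InnerProductSpace ℝ V]

/-- The warping factor `(α ‖a‖)²` cancels the `‖a‖⁻²` of the spherical components. What remains is
`α²` times the Euclidean metric plus a radial correction. -/
theorem alphaMetric_eq (α : ℝ) {a : V} (ha : a ≠ 0) (v w : V) :
    alphaMetric α a v w =
      α ^ 2 * inner ℝ v w + (1 - α ^ 2) * (inner ℝ a v * inner ℝ a w * (‖a‖ ^ 2)⁻¹) := by
  have h : ‖a‖ ≠ 0 := norm_ne_zero_iff.2 ha
  simp only [alphaMetric, warpedMetric, euclideanMetric, polarTangent, polar, RCLike.inner_apply,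
    conj_trivial, inner_sub_left, inner_sub_right, real_inner_smul_left, real_inner_smul_right,
    real_inner_self_eq_norm_sq, real_inner_comm a v]
  field_simp
  ring

theorem fderiv_alphaMetric (α : ℝ) {a : V} (ha : a ≠ 0) (u v w : V) :
    fderiv ℝ (fun y => alphaMetric α y v w) a u =
      (1 - α ^ 2) * ((inner ℝ u v * inner ℝ a w + inner ℝ a v * inner ℝ u w) * (‖a‖ ^ 2)⁻¹ -
        2 * (inner ℝ a v * inner ℝ a w) * inner ℝ a u * ((‖a‖ ^ 2)⁻¹) ^ 2) := by
  have h : ‖a‖ ≠ 0 := norm_ne_zero_iff.2 ha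
  have hl : ∀ z : V, HasFDerivAt (fun y : V => inner ℝ y z) (innerSL ℝ z) a := fun z => by
    simpa [real_inner_comm z] using (innerSL ℝ z).hasFDerivAt (x := a)
  have hn : HasFDerivAt (fun y : V => ‖y‖ ^ 2) (2 • innerSL ℝ a) a :=
    (hasStrictFDerivAt_norm_sq a).hasFDerivAt
  have hi := (hasDerivAt_inv (pow_ne_zero 2 h)).comp_hasFDerivAt a hn
  have h1 := ((((hl v).mul (hl w)).mul hi).const_mul (1 - α ^ 2)).const_add (α ^ 2 * inner ℝ v w)
  have h2 := h1.congr_of_eventuallyEq (f₁ := fun y => alphaMetric α y v w) (by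
    filter_upwards [isOpen_ne.mem_nhds ha] with y hy
    exact alphaMetric_eq α hy v w)
  rw [h2.fderiv]
  simp [real_inner_comm u]
  ring

/-- For smooth `σ` the last bracket is `r'' / r` with `r = ‖σ‖`. The warping thus enters only
through the norm of the curve. -/
theorem covariantAcceleration_alphaMetric (α : ℝ) {σ : ℝ → V} {t : ℝ} (h : σ t ≠ 0) (w : V) :
    covariantAcceleration (alphaMetric α) σ t w = α ^ 2 * inner ℝ (deriv (deriv σ) t) w +
      (1 - α ^ 2) * inner ℝ (σ t) w * ((inner ℝ (σ t) (deriv (deriv σ) t) + ‖deriv σ t‖ ^ 2) *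
        (‖σ t‖ ^ 2)⁻¹ - (inner ℝ (σ t) (deriv σ t) * (‖σ t‖ ^ 2)⁻¹) ^ 2) := by
  simp only [covariantAcceleration, christoffel, fderiv_alphaMetric α h, alphaMetric_eq α h,
    real_inner_self_eq_norm_sq, real_inner_comm (deriv σ t) w]
  ring

end AlphaMetric

/-! ### Second-order jets of real functions -/

/-- `f` has value `a`, first derivative `b` and second derivative `c` at `t`. -/
def HasJetAt (f : ℝ → ℝ) (a b c t : ℝ) : Prop :=
  ∃ f' : ℝ → ℝ, (∀ᶠ s in nhds t, HasDerivAt f (f' s) s) ∧ HasDerivAt f' c t ∧ f t = a ∧ f' t = b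

namespace HasJetAt

variable {f g : ℝ → ℝ} {a b c a' b' c' t : ℝ}

theorem unique (hf : HasJetAt f a b c t) (hf' : HasJetAt f a' b' c' t) :
    a = a' ∧ b = b' ∧ c = c' := by
  obtain ⟨f₁, h1, h2, rfl, rfl⟩ := hf
  obtain ⟨f₂, h3, h4, rfl, rfl⟩ := hf'
  have h5 : f₁ =ᶠ[nhds t] f₂ := by
    filter_upwards [h1, h3] with s hs hs'
    exact hs.unique hs'
  exact ⟨rfl, h5.self_of_nhds, h2.unique (h4.congr_of_eventuallyEq h5)⟩

theorem congr (hf : HasJetAt f a b c t) (h : g =ᶠ[nhds t] f) : HasJetAt g a b c t := by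
  obtain ⟨f', h1, h2, rfl, rfl⟩ := hf
  refine ⟨f', ?_, h2, h.self_of_nhds, rfl⟩
  filter_upwards [h1, h.eventually_nhds] with s hs hs'
  exact hs.congr_of_eventuallyEq hs'

theorem const (x t : ℝ) : HasJetAt (fun _ => x) x 0 0 t :=
  ⟨fun _ => 0, .of_forall fun s => hasDerivAt_const s x, hasDerivAt_const t 0, rfl, rfl⟩

theorem mul (hf : HasJetAt f a b c t) (hg : HasJetAt g a' b' c' t) :
    HasJetAt (fun s => f s * g s) (a * a') (b * a' + a * b') (c * a' + 2 * b * b' + a * c') t := by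
  obtain ⟨f', h1, h2, rfl, rfl⟩ := hf
  obtain ⟨g', h3, h4, rfl, rfl⟩ := hg
  refine ⟨fun s => f' s * g s + f s * g' s, ?_, ?_, rfl, rfl⟩
  · filter_upwards [h1, h3] with s hs hs'
    exact hs.mul hs'
  · refine ((h2.mul h3.self_of_nhds).add (h1.self_of_nhds.mul h4)).congr_deriv ?_
    ring

theorem add (hf : HasJetAt f a b c t) (hg : HasJetAt g a' b' c' t) :
    HasJetAt (fun s => f s + g s) (a + a') (b + b') (c + c') t := by
  obtain ⟨f', h1, h2, rfl, rfl⟩ := hf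
  obtain ⟨g', h3, h4, rfl, rfl⟩ := hg
  refine ⟨fun s => f' s + g' s, ?_, h2.add h4, rfl, rfl⟩
  filter_upwards [h1, h3] with s hs hs'
  exact hs.add hs'

theorem sum {ι : Type*} {s : Finset ι} {f : ι → ℝ → ℝ} {a b c : ι → ℝ}
    (h : ∀ i ∈ s, HasJetAt (f i) (a i) (b i) (c i) t) :
    HasJetAt (fun x => ∑ i ∈ s, f i x) (∑ i ∈ s, a i) (∑ i ∈ s, b i) (∑ i ∈ s, c i) t := by
  classical
  induction s using Finset.induction_on with
  | empty => simpa using const 0 t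
  | insert i s hi ih =>
    simp only [Finset.sum_insert hi]
    exact (h i (Finset.mem_insert_self i s)).add (ih fun j hj => h j (Finset.mem_insert_of_mem hj))

/-- With values `1` and first derivatives `0`, the cross terms vanish and second derivatives add.
This applies to `s ↦ ⟨u_i(s), u_i(t)⟩` at `s = t`, because a unit vector is orthogonal to its
velocity. -/
theorem prod {ι : Type*} {s : Finset ι} {f : ι → ℝ → ℝ} {c : ι → ℝ}
    (h : ∀ i ∈ s, HasJetAt (f i) 1 0 (c i) t) :
    HasJetAt (fun x => ∏ i ∈ s, f i x) 1 0 (∑ i ∈ s, c i) t := by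
  classical
  induction s using Finset.induction_on with
  | empty => simpa using const 1 t
  | insert i s hi ih =>
    simp only [Finset.sum_insert hi, Finset.prod_insert hi]
    simpa using (h i (Finset.mem_insert_self i s)).mul
      (ih fun j hj => h j (Finset.mem_insert_of_mem hj))

theorem pow (hf : HasJetAt f 1 0 c t) (m : ℕ) : HasJetAt (fun x => f x ^ m) 1 0 (m * c) t := by
  simpa using prod (s := (Finset.univ : Finset (Fin m))) (fun _ _ => hf)

end HasJetAt

theorem hasJetAt_radius {n : Fin d → ℕ} {γ : ℝ → FactorSpace n} {a b t : ℝ}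
    (hs : ContDiffOn ℝ ∞ γ (Ioo a b)) (ht : t ∈ Ioo a b) :
    HasJetAt (fun s => (γ s).1) (γ t).1 (deriv γ t).1 (deriv (deriv γ) t).1 t :=
  ⟨fun s => (deriv γ s).1, Filter.mem_of_superset (Ioo_mem_nhds ht.1 ht.2) fun _ hx =>
    hasDerivAt_radius (hasDerivAt_of_contDiffOn_Ioo hs hx),
    hasDerivAt_radius (hasDerivAt_of_contDiffOn_Ioo (contDiffOn_deriv_Ioo hs) ht), rfl, rfl⟩

theorem hasJetAt_inner_direction {n : Fin d → ℕ} {γ : ℝ → FactorSpace n} {a b t : ℝ}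
    (hs : ContDiffOn ℝ ∞ γ (Ioo a b)) (ht : t ∈ Ioo a b) (i : Fin d)
    (y : EuclideanSpace ℝ (Fin (n i))) :
    HasJetAt (fun s => inner ℝ ((γ s).2 i) y) (inner ℝ ((γ t).2 i) y)
      (inner ℝ ((deriv γ t).2 i) y) (inner ℝ ((deriv (deriv γ) t).2 i) y) t :=
  ⟨fun s => inner ℝ ((deriv γ s).2 i) y,
    Filter.mem_of_superset (Ioo_mem_nhds ht.1 ht.2) fun x hx => by
      simpa using (hasDerivAt_direction (hasDerivAt_of_contDiffOn_Ioo hs hx) i).inner ℝ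
        (hasDerivAt_const x y),
    by simpa using (hasDerivAt_direction
      (hasDerivAt_of_contDiffOn_Ioo (contDiffOn_deriv_Ioo hs) ht) i).inner ℝ
        (hasDerivAt_const t y), rfl, rfl⟩

theorem hasJetAt_inner {V : Type*} [NormedAddCommGroup V] [InnerProductSpace ℝ V] {σ : ℝ → V}
    {a b t : ℝ} (hs : ContDiffOn ℝ ∞ σ (Ioo a b)) (ht : t ∈ Ioo a b) (y : V) :
    HasJetAt (fun s => inner ℝ (σ s) y) (inner ℝ (σ t) y)
      (inner ℝ (deriv σ t) y) (inner ℝ (deriv (deriv σ) t) y) t :=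
  ⟨fun s => inner ℝ (deriv σ s) y,
    Filter.mem_of_superset (Ioo_mem_nhds ht.1 ht.2) fun x hx => by
      simpa using (hasDerivAt_of_contDiffOn_Ioo hs hx).inner ℝ (hasDerivAt_const x y),
    by simpa using (hasDerivAt_of_contDiffOn_Ioo (contDiffOn_deriv_Ioo hs) ht).inner ℝ
        (hasDerivAt_const t y), rfl, rfl⟩

/-! ### The Segre–Veronese map preserves covariant accelerations -/

section Transfer

variable {n k : Fin d → ℕ} {α a b : ℝ} {γ : ℝ → FactorSpace n}

theorem contDiffOn_segreVeroneseMap_comp (hs : ContDiffOn ℝ ∞ γ (Ioo a b)) :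
    ContDiffOn ℝ ∞ (fun s => segreVeroneseMap k (γ s)) (Ioo a b) :=
  (contDiff_segreVeroneseMap k).comp_contDiffOn hs

/-- The second-order expansion, tested against a tangent vector, of a curve in the
Segre–Veronese manifold. -/
theorem hasJetAt_inner_tangentTensor (hs : ContDiffOn ℝ ∞ γ (Ioo a b))
    (hm : ∀ t ∈ Ioo a b, γ t ∈ preSV n) {t : ℝ} (ht : t ∈ Ioo a b) {y : FactorSpace n}
    (hy : ∀ i, inner ℝ ((γ t).2 i) (y.2 i) = 0) :
    HasJetAt (fun s => inner ℝ (segreVeroneseMap k (γ s)) (tangentTensor k (γ t) y))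
      (y.1 * (γ t).1)
      (y.1 * (deriv γ t).1 +
        (γ t).1 ^ 2 * ∑ i, (k i : ℝ) * inner ℝ ((deriv γ t).2 i) (y.2 i))
      (y.1 * ((deriv (deriv γ) t).1 - (γ t).1 * ∑ i, (k i : ℝ) * ‖(deriv γ t).2 i‖ ^ 2) +
        (2 * (γ t).1 * (deriv γ t).1 * ∑ i, (k i : ℝ) * inner ℝ ((deriv γ t).2 i) (y.2 i) +
        (γ t).1 ^ 2 * ∑ i, (k i : ℝ) * inner ℝ ((deriv (deriv γ) t).2 i) (y.2 i))) t := by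
  have hr := hasJetAt_radius hs ht
  have hc : ∀ i, HasJetAt (fun s => inner ℝ ((γ s).2 i) ((γ t).2 i)) 1 0
      (-‖(deriv γ t).2 i‖ ^ 2) t := by
    intro i
    have := hasJetAt_inner_direction hs ht i ((γ t).2 i)
    rwa [real_inner_self_eq_norm_sq, (hm t ht).2 i, one_pow,
      real_inner_comm ((γ t).2 i), inner_deriv_eq_zero hs hm ht i,
      real_inner_comm ((γ t).2 i), inner_deriv_deriv_direction hs hm ht i] at this
  have hU := hr.mul (HasJetAt.prod (s := Finset.univ) fun i _ => (hc i).pow (k i))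
  -- The last factor `⟨u_i(s), y_i⟩` vanishes at `t`, so the second derivative of its coefficient
  -- drops out.
  have hV := HasJetAt.sum (s := Finset.univ) fun i _ =>
    (hr.mul ((HasJetAt.const (k i) t).mul (((hc i).pow (k i - 1)).mul
      (HasJetAt.prod (s := Finset.univ.erase i) fun j _ => (hc j).pow (k j))))).mul
      (hasJetAt_inner_direction hs ht i (y.2 i))
  have h := ((HasJetAt.const y.1 t).mul hU).add ((HasJetAt.const (γ t).1 t).mul hV)
  have h' := h.congr (g := fun s =>
      inner ℝ (segreVeroneseMap k (γ s)) (tangentTensor k (γ t) y)) (.of_forall fun s => by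
    simp only [tangentTensor_eq, inner_add_right, real_inner_smul_right, inner_sum,
      inner_segreVeroneseMap, inner_segreVeroneseMap_slotTensor, mul_one, mul_assoc])
  convert h' using 1
  · simp [hy]
  · simp only [hy, Finset.mul_sum, mul_zero, zero_mul, mul_one, zero_add, add_zero,
      Finset.sum_const_zero]
    congr 1
    exact Finset.sum_congr rfl fun i _ => by ring
  · simp only [hy, Finset.mul_sum, mul_zero, zero_mul, mul_one, zero_add, add_zero,
      ← Finset.sum_add_distrib, mul_neg, Finset.sum_neg_distrib, ← sub_eq_add_neg]
    congr 1
    exact Finset.sum_congr rfl fun i _ => by ring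

/-- The acceleration downstairs involves only `⟨σ, w⟩`, `⟨σ'', w⟩` and the jet of `‖σ‖²`. The first
two are known from the jet against a tangent tensor, and the third is the jet of the squared radius
since `‖σ‖ = r`. -/
theorem covariantAcceleration_segreVeroneseMap (hs : ContDiffOn ℝ ∞ γ (Ioo a b))
    (hm : ∀ t ∈ Ioo a b, γ t ∈ preSV n) {t : ℝ} (ht : t ∈ Ioo a b) {y : FactorSpace n}
    (hy : ∀ i, inner ℝ ((γ t).2 i) (y.2 i) = 0) :
    covariantAcceleration (alphaMetric α) (fun s => segreVeroneseMap k (γ s)) t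
        (tangentTensor k (γ t) y) = covariantAcceleration (preSVMetric α n k) γ t y := by
  set σ : ℝ → TensorSpace n k := fun s => segreVeroneseMap k (γ s) with hσ
  have hσs : ContDiffOn ℝ ∞ σ (Ioo a b) := contDiffOn_segreVeroneseMap_comp hs
  have hr : 0 < (γ t).1 := (hm t ht).1
  have hn : ∀ s ∈ Ioo a b, ‖σ s‖ = (γ s).1 := fun s hs' => norm_segreVeroneseMap (hm s hs')
  have h0 : σ t ≠ 0 := norm_ne_zero_iff.1 (by rw [hn t ht]; exact hr.ne')
  obtain ⟨h1, -, h2⟩ := (hasJetAt_inner hσs ht (tangentTensor k (γ t) y)).unique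
    (hasJetAt_inner_tangentTensor hs hm ht hy)
  have hsq : HasJetAt (fun s => (γ s).1 * (γ s).1) (‖σ t‖ ^ 2)
      (2 * inner ℝ (σ t) (deriv σ t))
      (2 * (inner ℝ (σ t) (deriv (deriv σ) t) + ‖deriv σ t‖ ^ 2)) t := by
    refine ⟨fun s => 2 * inner ℝ (σ s) (deriv σ s), ?_, ?_, ?_, rfl⟩
    · filter_upwards [Ioo_mem_nhds ht.1 ht.2] with s hs'
      have h3 := hasDerivAt_of_contDiffOn_Ioo hσs hs'
      refine ((h3.inner ℝ h3).congr_of_eventuallyEq ?_).congr_deriv ?_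
      · filter_upwards [Ioo_mem_nhds hs'.1 hs'.2] with x hx
        rw [real_inner_self_eq_norm_sq, hn x hx, sq]
      · rw [real_inner_comm (σ s) (deriv σ s)]
        ring
    · have h3 := hasDerivAt_of_contDiffOn_Ioo hσs ht
      have h4 := hasDerivAt_of_contDiffOn_Ioo (contDiffOn_deriv_Ioo hσs) ht
      refine ((h3.inner ℝ h4).const_mul 2).congr_deriv ?_
      rw [real_inner_self_eq_norm_sq]
    · rw [hn t ht, sq]
  have hrj := hasJetAt_radius hs ht
  obtain ⟨-, h3, h4⟩ := hsq.unique (hrj.mul hrj)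
  have h5 : inner ℝ (σ t) (deriv σ t) = (γ t).1 * (deriv γ t).1 := by linarith
  have h6 : inner ℝ (σ t) (deriv (deriv σ) t) + ‖deriv σ t‖ ^ 2 =
      (γ t).1 * (deriv (deriv γ) t).1 + (deriv γ t).1 ^ 2 := by linarith
  rw [covariantAcceleration_alphaMetric α h0, h2, h5, h6, hn t ht, h1,
    covariantAcceleration_preSVMetric]
  field_simp
  ring

end Transfer

/-! ### A smooth local inverse of the Segre–Veronese map -/

section LocalInverse

variable {n : Fin d → ℕ}

/-- The contraction of a tensor with the vectors `u_j` in all slots but one of the `i`-th factor,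
averaged over those slots. -/
noncomputable def contraction (k : Fin d → ℕ) (u : (i : Fin d) → EuclideanSpace ℝ (Fin (n i)))
    (i : Fin d) (T : TensorSpace n k) : EuclideanSpace ℝ (Fin (n i)) :=
  WithLp.toLp 2 fun a => inner ℝ T (slotTensor k u i (EuclideanSpace.single a 1))

/-- A left inverse of the Segre–Veronese map near the points with directions `u`. -/
noncomputable def localInverse (k : Fin d → ℕ) (u : (i : Fin d) → EuclideanSpace ℝ (Fin (n i)))
    (T : TensorSpace n k) : FactorSpace n :=
  (‖T‖, fun i => ‖contraction k u i T‖⁻¹ • contraction k u i T)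

/-- The points of the pre-Segre–Veronese manifold whose directions form acute angles with `u`. -/
def acuteSV (u : (i : Fin d) → EuclideanSpace ℝ (Fin (n i))) : Set (FactorSpace n) :=
  {q | q ∈ preSV n ∧ ∀ i, 0 < inner ℝ (q.2 i) (u i)}

variable {k : Fin d → ℕ} {u : (i : Fin d) → EuclideanSpace ℝ (Fin (n i))}

theorem mem_acuteSV_self {p : FactorSpace n} (hp : p ∈ preSV n) : p ∈ acuteSV p.2 :=
  ⟨hp, fun i => by rw [real_inner_self_eq_norm_sq, hp.2 i]; norm_num⟩

theorem contraction_segreVeroneseMap (i : Fin d) (q : FactorSpace n) :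
    contraction k u i (segreVeroneseMap k q) =
      (q.1 * (k i * inner ℝ (q.2 i) (u i) ^ (k i - 1) *
        ∏ j ∈ Finset.univ.erase i, inner ℝ (q.2 j) (u j) ^ k j)) • q.2 i := by
  ext a
  simp [contraction, inner_segreVeroneseMap_slotTensor, EuclideanSpace.inner_single_right]

/-- Acute angles make the proportionality factor positive, so normalizing the contraction returns
the direction itself and not its negative. -/
theorem exists_contraction_eq (hk : ∀ i, 1 ≤ k i) (i : Fin d) {q : FactorSpace n}
    (hq : q ∈ acuteSV u) :
    ∃ c : ℝ, 0 < c ∧ contraction k u i (segreVeroneseMap k q) = c • q.2 i := by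
  refine ⟨_, ?_, contraction_segreVeroneseMap i q⟩
  have h1 : (0 : ℝ) < k i := by exact_mod_cast hk i
  exact mul_pos hq.1.1 (mul_pos (mul_pos h1 (pow_pos (hq.2 i) _))
    (Finset.prod_pos fun j _ => pow_pos (hq.2 j) _))

theorem localInverse_segreVeroneseMap (hk : ∀ i, 1 ≤ k i) {q : FactorSpace n}
    (hq : q ∈ acuteSV u) : localInverse k u (segreVeroneseMap k q) = q := by
  refine Prod.ext (norm_segreVeroneseMap hq.1) (funext fun i => ?_)
  obtain ⟨c, hc, h⟩ := exists_contraction_eq hk i hq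
  simp only [localInverse, h, norm_smul, hq.1.2 i, norm_of_nonneg hc.le, mul_one, smul_smul,
    inv_mul_cancel₀ hc.ne', one_smul]

theorem contDiff_contraction (i : Fin d) :
    ContDiff ℝ ∞ (contraction k u i : TensorSpace n k → EuclideanSpace ℝ (Fin (n i))) :=
  (contDiff_piLp 2).2 fun _ => contDiff_id.inner ℝ contDiff_const

theorem contDiffAt_localInverse (hk : ∀ i, 1 ≤ k i) {q : FactorSpace n} (hq : q ∈ acuteSV u) :
    ContDiffAt ℝ ∞ (localInverse k u) (segreVeroneseMap k q) := by
  have h0 : segreVeroneseMap k q ≠ 0 := norm_ne_zero_iff.1 (by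
    rw [norm_segreVeroneseMap hq.1]
    exact hq.1.1.ne')
  refine (contDiffAt_id.norm ℝ h0).prodMk (contDiffAt_pi.2 fun i => ?_)
  obtain ⟨c, hc, h⟩ := exists_contraction_eq hk i hq
  have h1 : contraction k u i (segreVeroneseMap k q) ≠ 0 := norm_ne_zero_iff.1 (by
    rw [h, norm_smul, hq.1.2 i, norm_of_nonneg hc.le, mul_one]
    exact hc.ne')
  have h2 := (contDiff_contraction (k := k) (u := u) i).contDiffAt (x := segreVeroneseMap k q)
  exact ((h2.norm ℝ h1).inv (norm_ne_zero_iff.2 h1)).smul h2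

theorem segreVeroneseMap_smul_directions (k : Fin d → ℕ) (q : FactorSpace n) (c : Fin d → ℝ) :
    segreVeroneseMap k (q.1, fun i => c i • q.2 i) = (∏ i, c i ^ k i) • segreVeroneseMap k q := by
  ext j
  simp [segreVeroneseMap, arrayTensor, tensorPow, vecTensor, Finset.prod_mul_distrib]
  ring

/-- The tensors near the image of a point with directions `u` have an acute preimage. -/
theorem exists_mem_acuteSV (hk : ∀ i, 1 ≤ k i) {p : FactorSpace n} (hp : p ∈ preSV n)
    {T : TensorSpace n k}
    (hT : T ∈ segreVeronese n k) (h : 0 < inner ℝ T (segreVeroneseMap k p)) :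
    ∃ q ∈ acuteSV p.2, segreVeroneseMap k q = T := by
  obtain ⟨q, hq, rfl⟩ := hT
  rw [inner_segreVeroneseMap] at h
  have hp1 : 0 < p.1 := hp.1
  have hq1 : 0 < q.1 := hq.1
  have hprod : 0 < ∏ i, inner ℝ (q.2 i) (p.2 i) ^ k i :=
    pos_of_mul_pos_right h (mul_pos hq1 hp1).le
  have hne : ∀ i, inner ℝ (q.2 i) (p.2 i) ≠ 0 := fun i hi =>
    hprod.ne' (Finset.prod_eq_zero (Finset.mem_univ i)
      (by rw [hi, zero_pow (Nat.one_le_iff_ne_zero.1 (hk i))]))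
  -- Flipping the directions that form obtuse angles makes all angles acute. The tensor is unchanged
  -- because the total sign `∏ c_i ^ k_i` is `±1` and, by positivity of the products before and
  -- after the flip, positive.
  set c : Fin d → ℝ := fun i => if 0 < inner ℝ (q.2 i) (p.2 i) then 1 else -1 with hc
  have hc1 : ∀ i, c i ^ 2 = 1 := fun i => by
    simp only [hc]
    split_ifs <;> norm_num
  have hc2 : ∀ i, 0 < c i * inner ℝ (q.2 i) (p.2 i) := fun i => by
    simp only [hc]
    split_ifs with h1
    · simpa using h1
    · rw [neg_one_mul]
      exact neg_pos.2 (lt_of_le_of_ne (not_lt.1 h1) (hne i))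
  have hs : 0 < ∏ i, c i ^ k i := by
    refine pos_of_mul_pos_left (b := ∏ i, inner ℝ (q.2 i) (p.2 i) ^ k i) ?_ hprod.le
    rw [← Finset.prod_mul_distrib]
    exact Finset.prod_pos fun i _ => by
      rw [← mul_pow]
      exact pow_pos (hc2 i) _
  have hs1 : ∏ i, c i ^ k i = 1 := by
    have h2 : (∏ i, c i ^ k i) ^ 2 = 1 := by
      rw [← Finset.prod_pow]
      exact Finset.prod_eq_one fun i _ => by rw [← pow_mul, mul_comm, pow_mul, hc1, one_pow]
    nlinarith
  refine ⟨(q.1, fun i => c i • q.2 i), ⟨⟨hq1, fun i => ?_⟩, fun i => ?_⟩, ?_⟩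
  · have : |c i| = 1 := by
      rw [← sq_eq_sq₀ (abs_nonneg _) zero_le_one, sq_abs, hc1, one_pow]
    rw [norm_smul, hq.2 i, norm_eq_abs, this, one_mul]
  · rw [real_inner_smul_left]
    exact hc2 i
  · rw [segreVeroneseMap_smul_directions, hs1, one_smul]

/-- A curve in the Segre–Veronese manifold lifts smoothly near a given time, with a prescribed
value at that time. -/
theorem exists_lift (hk : ∀ i, 1 ≤ k i) {σ : ℝ → TensorSpace n k} {a b t₀ : ℝ}
    (hs : ContDiffOn ℝ ∞ σ (Ioo a b)) (hm : ∀ t ∈ Ioo a b, σ t ∈ segreVeronese n k)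
    (ht₀ : t₀ ∈ Ioo a b) {p : FactorSpace n} (hp : p ∈ preSV n)
    (hpσ : segreVeroneseMap k p = σ t₀) :
    ∃ (ε : ℝ) (γ : ℝ → FactorSpace n), 0 < ε ∧ Ioo (t₀ - ε) (t₀ + ε) ⊆ Ioo a b ∧
      ContDiffOn ℝ ∞ γ (Ioo (t₀ - ε) (t₀ + ε)) ∧ (∀ t ∈ Ioo (t₀ - ε) (t₀ + ε), γ t ∈ preSV n) ∧
      (∀ t ∈ Ioo (t₀ - ε) (t₀ + ε), segreVeroneseMap k (γ t) = σ t) ∧ γ t₀ = p := by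
  have h1 : ContinuousAt (fun t => inner ℝ (σ t) (segreVeroneseMap k p)) t₀ :=
    (contDiffAt_of_contDiffOn_Ioo hs ht₀).continuousAt.inner continuousAt_const
  have h2 : 0 < inner ℝ (σ t₀) (segreVeroneseMap k p) := by
    rw [← hpσ, real_inner_self_eq_norm_sq, norm_segreVeroneseMap hp]
    exact pow_pos hp.1 2
  -- Near `t₀` the curve stays in the half-space where acute preimages exist, so the smooth left
  -- inverse lifts it.
  obtain ⟨ε, hε, h3⟩ := Metric.mem_nhds_iff.1
    (Filter.inter_mem (h1.eventually (lt_mem_nhds h2)) (Ioo_mem_nhds ht₀.1 ht₀.2))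
  rw [ball_eq_Ioo] at h3
  have h4 : ∀ t ∈ Ioo (t₀ - ε) (t₀ + ε), ∃ q ∈ acuteSV p.2, segreVeroneseMap k q = σ t :=
    fun t ht => exists_mem_acuteSV hk hp (hm t (h3 ht).2) (h3 ht).1
  refine ⟨ε, fun t => localInverse k p.2 (σ t), hε, fun t ht => (h3 ht).2, ?_, ?_, ?_, ?_⟩
  · intro t ht
    obtain ⟨q, hq, h5⟩ := h4 t ht
    have h6 := contDiffAt_localInverse hk hq
    rw [h5] at h6
    exact (h6.comp t (contDiffAt_of_contDiffOn_Ioo hs (h3 ht).2)).contDiffWithinAt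
  · intro t ht
    obtain ⟨q, hq, h5⟩ := h4 t ht
    simpa only [← h5, localInverse_segreVeroneseMap hk hq] using hq.1
  · intro t ht
    obtain ⟨q, hq, h5⟩ := h4 t ht
    simp only [← h5, localInverse_segreVeroneseMap hk hq]
  · simp only [← hpσ, localInverse_segreVeroneseMap hk (mem_acuteSV_self hp)]

theorem tangentTensor_mem_tangentSpaceAt {p v : FactorSpace n}
    (hv : v ∈ tangentSpaceAt (preSV n) p) :
    tangentTensor k p v ∈ tangentSpaceAt (segreVeronese n k) (segreVeroneseMap k p) := by
  obtain ⟨ε, c, hε, hs, hm, rfl, hc⟩ := hv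
  exact ⟨ε, fun t => segreVeroneseMap k (c t), hε, contDiffOn_segreVeroneseMap_comp hs,
    fun t ht => ⟨c t, hm t ht, rfl⟩, rfl, hasDerivAt_segreVeroneseMap k hc⟩

/-- A curve with velocity `P'` lifts locally through `p`, and the velocity of the lift is the
preimage. -/
theorem exists_eq_tangentTensor (hk : ∀ i, 1 ≤ k i) {p : FactorSpace n} (hp : p ∈ preSV n)
    {P' : TensorSpace n k}
    (h : P' ∈ tangentSpaceAt (segreVeronese n k) (segreVeroneseMap k p)) :
    ∃ v ∈ tangentSpaceAt (preSV n) p, P' = tangentTensor k p v := by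
  obtain ⟨ε, σ, hε, hs, hm, h0, hσ⟩ := h
  obtain ⟨δ, γ, hδ, -, hγs, hγm, hγσ, rfl⟩ := exists_lift hk hs hm ⟨neg_lt_zero.2 hε, hε⟩ hp h0.symm
  rw [zero_sub, zero_add] at hγs hγm hγσ
  have h0 : (0 : ℝ) ∈ Ioo (-δ) δ := ⟨neg_lt_zero.2 hδ, hδ⟩
  have hd := hasDerivAt_of_contDiffOn_Ioo hγs h0
  refine ⟨deriv γ 0, ⟨δ, γ, hδ, hγs, hγm, rfl, hd⟩, ?_⟩
  exact hσ.unique ((hasDerivAt_segreVeroneseMap k hd).congr_of_eventuallyEq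
    (Filter.mem_of_superset (Ioo_mem_nhds h0.1 h0.2) fun t ht => (hγσ t ht).symm))

theorem eventually_localInverse_eq (hk : ∀ i, 1 ≤ k i) {γ : ℝ → FactorSpace n} {t : ℝ}
    (hm : ∀ᶠ s in nhds t, γ s ∈ preSV n) (hc : ContinuousAt γ t) :
    ∀ᶠ s in nhds t, localInverse k (γ t).2 (segreVeroneseMap k (γ s)) = γ s := by
  have h1 : ∀ i, ∀ᶠ s in nhds t, 0 < inner ℝ ((γ s).2 i) ((γ t).2 i) := fun i => by
    have h2 : ContinuousAt (fun s => inner ℝ ((γ s).2 i) ((γ t).2 i)) t :=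
      (continuousAt_pi.1 hc.snd i).inner continuousAt_const
    exact h2.eventually (lt_mem_nhds ((mem_acuteSV_self hm.self_of_nhds).2 i))
  filter_upwards [hm, Filter.eventually_all.2 h1] with s hs hs'
  exact localInverse_segreVeroneseMap hk ⟨hs, hs'⟩

/-- The velocity of a curve is determined by the velocity of its image. -/
theorem eq_fderiv_localInverse (hk : ∀ i, 1 ≤ k i) {γ : ℝ → FactorSpace n} {t : ℝ}
    {v : FactorSpace n} (hm : ∀ᶠ s in nhds t, γ s ∈ preSV n) (hv : HasDerivAt γ v t) :
    v = fderiv ℝ (localInverse k (γ t).2) (segreVeroneseMap k (γ t)) (tangentTensor k (γ t) v) := by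
  have h1 := (contDiffAt_localInverse hk (mem_acuteSV_self hm.self_of_nhds)).differentiableAt
    (by simp)
  have h2 := h1.hasFDerivAt.comp_hasDerivAt t (hasDerivAt_segreVeroneseMap k hv)
  refine hv.unique (h2.congr_of_eventuallyEq ?_)
  filter_upwards [eventually_localInverse_eq hk hm hv.continuousAt] with s hs
  exact hs.symm

theorem tangentTensor_injOn (hk : ∀ i, 1 ≤ k i) (p : FactorSpace n) :
    InjOn (tangentTensor k p) (tangentSpaceAt (preSV n) p) := by
  have h : ∀ v ∈ tangentSpaceAt (preSV n) p,
      v = fderiv ℝ (localInverse k p.2) (segreVeroneseMap k p) (tangentTensor k p v) := by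
    rintro v ⟨ε, c, hε, -, hm, rfl, hc⟩
    exact eq_fderiv_localInverse hk
      (Filter.mem_of_superset (Ioo_mem_nhds (neg_lt_zero.2 hε) hε) hm) hc
  intro v hv w hw hvw
  rw [h v hv, h w hw, hvw]

end LocalInverse

/-! ### Geodesics of the Segre–Veronese manifold -/

section Geodesics

variable {n k : Fin d → ℕ} {α a b : ℝ}

theorem IsGeodesicOn.mono {E : Type*} [NormedAddCommGroup E] [NormedSpace ℝ E] {M : Set E}
    {g : E → E → E → ℝ} {γ : ℝ → E} {I J : Set ℝ} (h : IsGeodesicOn M g I γ) (hJ : J ⊆ I) :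
    IsGeodesicOn M g J γ :=
  ⟨h.smooth.mono hJ, fun t ht => h.mem t (hJ ht), fun t ht => h.acceleration_eq_zero t (hJ ht)⟩

theorem deriv_segreVeroneseMap_comp {γ : ℝ → FactorSpace n} (hs : ContDiffOn ℝ ∞ γ (Ioo a b))
    {t : ℝ} (ht : t ∈ Ioo a b) :
    deriv (fun s => segreVeroneseMap k (γ s)) t = tangentTensor k (γ t) (deriv γ t) :=
  (hasDerivAt_segreVeroneseMap k (hasDerivAt_of_contDiffOn_Ioo hs ht)).deriv

/-- Every tangent vector downstairs is the image of one upstairs, so equality of accelerations on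
such images suffices. -/
theorem IsGeodesicOn.segreVeroneseMap_comp (hk : ∀ i, 1 ≤ k i) {γ : ℝ → FactorSpace n}
    (h : IsGeodesicOn (preSV n) (preSVMetric α n k) (Ioo a b) γ) :
    IsGeodesicOn (segreVeronese n k) (alphaMetric α) (Ioo a b)
      (fun s => segreVeroneseMap k (γ s)) := by
  refine ⟨contDiffOn_segreVeroneseMap_comp h.smooth, fun t ht => ⟨γ t, h.mem t ht, rfl⟩,
    fun t ht w hw => ?_⟩
  obtain ⟨y, hy, rfl⟩ := exists_eq_tangentTensor hk (h.mem t ht) hw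
  rw [covariantAcceleration_segreVeroneseMap h.smooth h.mem ht
    ((mem_tangentSpaceAt_preSV (h.mem t ht)).1 hy)]
  exact h.acceleration_eq_zero t ht y hy

theorem covariantAcceleration_congr {E : Type*} [NormedAddCommGroup E] [NormedSpace ℝ E]
    (g : E → E → E → ℝ) {γ₁ γ₂ : ℝ → E} {t : ℝ} (h : γ₁ =ᶠ[nhds t] γ₂) (w : E) :
    covariantAcceleration g γ₁ t w = covariantAcceleration g γ₂ t w := by
  simp only [covariantAcceleration, h.self_of_nhds, h.deriv.self_of_nhds,
    h.deriv.deriv.self_of_nhds]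

theorem isGeodesicOn_of_segreVeroneseMap_comp {γ : ℝ → FactorSpace n} {σ : ℝ → TensorSpace n k}
    (hσ : IsGeodesicOn (segreVeronese n k) (alphaMetric α) (Ioo a b) σ)
    (hs : ContDiffOn ℝ ∞ γ (Ioo a b)) (hm : ∀ t ∈ Ioo a b, γ t ∈ preSV n)
    (h : ∀ t ∈ Ioo a b, segreVeroneseMap k (γ t) = σ t) :
    IsGeodesicOn (preSV n) (preSVMetric α n k) (Ioo a b) γ := by
  refine ⟨hs, hm, fun t ht y hy => ?_⟩
  rw [← covariantAcceleration_segreVeroneseMap hs hm ht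
    ((mem_tangentSpaceAt_preSV (hm t ht)).1 hy), covariantAcceleration_congr _
      (Filter.mem_of_superset (Ioo_mem_nhds ht.1 ht.2) h)]
  refine hσ.acceleration_eq_zero t ht _ ?_
  rw [← h t ht]
  exact tangentTensor_mem_tangentSpaceAt hy

/-- A geodesic of the Segre–Veronese manifold that is tangent to the image of a geodesic of the
pre-Segre–Veronese manifold coincides with it. -/
theorem eqOn_segreVeroneseMap_comp (hk : ∀ i, 1 ≤ k i) (hα : 0 < α) {γ : ℝ → FactorSpace n}
    {σ : ℝ → TensorSpace n k} (hγ : IsGeodesicOn (preSV n) (preSVMetric α n k) (Ioo a b) γ)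
    (hσ : IsGeodesicOn (segreVeronese n k) (alphaMetric α) (Ioo a b) σ) {s : ℝ}
    (hs : s ∈ Ioo a b) (h : σ s = segreVeroneseMap k (γ s))
    (h' : deriv σ s = tangentTensor k (γ s) (deriv γ s)) :
    EqOn σ (fun t => segreVeroneseMap k (γ t)) (Ioo a b) := by
  set τ : ℝ → TensorSpace n k := fun t => segreVeroneseMap k (γ t) with hτ
  have hτg : IsGeodesicOn (segreVeronese n k) (alphaMetric α) (Ioo a b) τ :=
    hγ.segreVeroneseMap_comp hk
  have hτ' : ∀ t ∈ Ioo a b, deriv τ t = tangentTensor k (γ t) (deriv γ t) :=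
    fun t ht => deriv_segreVeroneseMap_comp hγ.smooth ht
  -- Lifts exist only locally in time, so the set of times of first-order contact is shown to be
  -- open (by lifting and uniqueness upstairs) and relatively closed (by continuity).
  set A : Set ℝ := {t | t ∈ Ioo a b ∧ σ t = τ t ∧ deriv σ t = deriv τ t} with hA
  have hopen : IsOpen A := by
    rw [isOpen_iff_mem_nhds]
    rintro t₀ ⟨ht₀, h1, h2⟩
    obtain ⟨ε, ψ, hε, hsub, hψs, hψm, hψσ, hψ0⟩ :=
      exists_lift hk hσ.smooth hσ.mem ht₀ (hγ.mem t₀ ht₀) h1.symm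
    have hψ := isGeodesicOn_of_segreVeroneseMap_comp (hσ.mono hsub) hψs hψm hψσ
    have ht₁ : t₀ ∈ Ioo (t₀ - ε) (t₀ + ε) := ⟨by linarith, by linarith⟩
    have hψd : deriv ψ t₀ = deriv γ t₀ := by
      refine tangentTensor_injOn hk (γ t₀) ?_ ?_ ?_
      · rw [mem_tangentSpaceAt_preSV (hγ.mem t₀ ht₀), ← hψ0]
        exact inner_deriv_eq_zero hψs hψm ht₁
      · rw [mem_tangentSpaceAt_preSV (hγ.mem t₀ ht₀)]
        exact inner_deriv_eq_zero hγ.smooth hγ.mem ht₀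
      · rw [← hτ' t₀ ht₀, ← h2, ← hψ0, ← deriv_segreVeroneseMap_comp hψs ht₁]
        exact (Filter.eventuallyEq_of_mem (Ioo_mem_nhds ht₁.1 ht₁.2) hψσ).deriv_eq
    have heq := hψ.eqOn hk hα (hγ.mono hsub) ht₁ hψ0 hψd
    have hστ : EqOn σ τ (Ioo (t₀ - ε) (t₀ + ε)) := fun t ht => by
      rw [← hψσ t ht, heq ht]
    refine Filter.mem_of_superset (Ioo_mem_nhds ht₁.1 ht₁.2) fun t ht => ⟨hsub ht, hστ ht, ?_⟩
    exact (Filter.eventuallyEq_of_mem (Ioo_mem_nhds ht.1 ht.2) hστ).deriv_eq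
  have hclosed : closure A ∩ Ioo a b ⊆ A := by
    rintro t ⟨ht, htab⟩
    have := mem_closure_iff_nhdsWithin_neBot.1 ht
    have lim : ∀ {f g : ℝ → TensorSpace n k}, ContinuousAt f t → ContinuousAt g t →
        (∀ x ∈ A, f x = g x) → f t = g t := by
      intro f g hf hg hfg
      refine tendsto_nhds_unique_of_eventuallyEq (hf.mono_left nhdsWithin_le_nhds)
        (hg.mono_left nhdsWithin_le_nhds) ?_ (l := nhdsWithin t A)
      filter_upwards [self_mem_nhdsWithin] with x hx using hfg x hx
    exact ⟨htab, lim (hσ.hasDerivAt htab).continuousAt (hτg.hasDerivAt htab).continuousAt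
      fun x hx => hx.2.1, lim (hσ.hasDerivAt_deriv htab).continuousAt
      (hτg.hasDerivAt_deriv htab).continuousAt fun x hx => hx.2.2⟩
  have hsubset : Ioo a b ⊆ A := isPreconnected_Ioo.subset_of_closure_inter_subset hopen
    ⟨s, hs, hs, h, by rw [h', hτ' s hs]⟩ hclosed
  exact fun t ht => (hsubset ht).2.1

/-- The starting geodesics of the pre-Segre–Veronese manifold agree at time `1`. -/
theorem IsStartingGeodesic.eq_one (hk : ∀ i, 1 ≤ k i) (hα : 0 < α) {p v : FactorSpace n}
    {γ₁ γ₂ : ℝ → FactorSpace n} (h₁ : IsStartingGeodesic (preSV n) (preSVMetric α n k) p v γ₁)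
    (h₂ : IsStartingGeodesic (preSV n) (preSVMetric α n k) p v γ₂) : γ₁ 1 = γ₂ 1 := by
  obtain ⟨h1, h2, a, b, ha, hb, h3⟩ := h₁
  obtain ⟨h4, h5, a', b', ha', hb', h6⟩ := h₂
  refine (h3.mono (Ioo_subset_Ioo (le_max_left a a') (min_le_left b b'))).eqOn hk hα
    (h6.mono (Ioo_subset_Ioo (le_max_right a a') (min_le_right b b'))) (s := 0) ?_
    (h1.trans h4.symm) (h2.trans h5.symm) ?_
  · exact ⟨max_lt ha ha', lt_min (by linarith) (by linarith)⟩
  · exact ⟨max_lt (by linarith) (by linarith), lt_min hb hb'⟩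

/-! ### Existence of starting geodesics and the exponential maps -/

theorem isStartingGeodesic_preSVGeodesic (hk : ∀ i, 1 ≤ k i) (hα : 0 < α) {p v : FactorSpace n}
    (hp : p ∈ preSV n) (hv : ∀ i, inner ℝ (p.2 i) (v.2 i) = 0) (h : ¬ (v.2 = 0 ∧ v.1 ≤ -p.1)) :
    IsStartingGeodesic (preSV n) (preSVMetric α n k) p v (preSVGeodesic α k p v) := by
  have hp1 : 0 < p.1 := hp.1
  -- On `[0, 1]` the line must avoid the branch cut of `arg`. If `N > 0`, it leaves the real axis at
  -- once; if `N = 0`, it stays on the positive real axis because `r' > -r`.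
  have hmem : ∀ t ∈ Icc (0 : ℝ) 1, unrolledCurve α k p v t ∈ Complex.slitPlane := by
    intro t ht
    rw [Complex.mem_slitPlane_iff]
    by_cases h0 : t = 0
    · left
      simpa [unrolledCurve, h0] using hp1
    · by_cases hN : sphericalSpeed k v = 0
      · left
        have h1 : -p.1 < v.1 := not_le.1 fun h1 => h ⟨(sphericalSpeed_eq_zero_iff hk).1 hN, h1⟩
        have h2 : 0 < t := lt_of_le_of_ne ht.1 (Ne.symm h0)
        change 0 < p.1 + t * v.1
        nlinarith [ht.2]
      · right
        exact mul_ne_zero h0 (mul_ne_zero (mul_ne_zero hp1.ne' hα.ne') hN)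
  have hopen : IsOpen (unrolledCurve α k p v ⁻¹' Complex.slitPlane) :=
    Complex.isOpen_slitPlane.preimage (contDiff_unrolledCurve (α := α) (k := k)).continuous
  obtain ⟨δ, hδ, hsub⟩ := isCompact_Icc.exists_thickening_subset_open hopen hmem
  refine ⟨preSVGeodesic_zero hp, deriv_preSVGeodesic_zero hk hα hp, -δ, 1 + δ, by linarith,
    by linarith, isGeodesicOn_preSVGeodesic hk hα hp hv fun t ht => hsub ?_⟩
  rw [Metric.mem_thickening_iff]
  rcases lt_or_ge t 0 with h1 | h1
  · exact ⟨0, by simp, by rw [dist_eq, abs_lt]; constructor <;> linarith [ht.1]⟩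
  · rcases lt_or_ge 1 t with h2 | h2
    · exact ⟨1, by simp, by rw [dist_eq, abs_lt]; constructor <;> linarith [ht.2]⟩
    · exact ⟨t, ⟨h1, h2⟩, by simpa using hδ⟩

theorem mem_expDomain_preSV_iff (hk : ∀ i, 1 ≤ k i) (hα : 0 < α) {p v : FactorSpace n}
    (hp : p ∈ preSV n) (hv : v ∈ tangentSpaceAt (preSV n) p) :
    v ∈ expDomain (preSV n) (preSVMetric α n k) p ↔ ¬ (v.2 = 0 ∧ v.1 ≤ -p.1) := by
  constructor
  · rintro ⟨γ, h0, h1, a, b, ha, hb, hγ⟩ ⟨h2, h3⟩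
    have hp1 : 0 < p.1 := hp.1
    have hv1 : v.1 < 0 := by linarith
    -- This is the time, at most `1`, at which a radial geodesic would reach radius `0`.
    have ht : p.1 / -v.1 ∈ Ioo a b := by
      constructor
      · exact ha.trans (div_pos hp1 (by linarith))
      · exact ((div_le_one (by linarith)).2 (by linarith)).trans_lt hb
    have h4 := hγ.sq_radius_eq hk hα (s := 0) ⟨ha, by linarith⟩ ht
    rw [h0, h1, h2] at h4
    have h5 : p.1 + (p.1 / -v.1 - 0) * v.1 = 0 := by
      rw [sub_zero, div_neg, neg_mul, div_mul_cancel₀ _ hv1.ne, add_neg_cancel]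
    rw [h5] at h4
    have h6 := pow_pos (hγ.mem _ ht).1 2
    rw [h4] at h6
    simp at h6
  · exact fun h => ⟨_, isStartingGeodesic_preSVGeodesic hk hα hp
      ((mem_tangentSpaceAt_preSV hp).1 hv) h⟩

theorem IsStartingGeodesic.mem_tangentSpaceAt {E : Type*} [NormedAddCommGroup E]
    [NormedSpace ℝ E] {M : Set E} {g : E → E → E → ℝ} {x v : E} {γ : ℝ → E}
    (h : IsStartingGeodesic M g x v γ) : v ∈ tangentSpaceAt M x := by
  obtain ⟨rfl, rfl, a, b, ha, hb, h⟩ := h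
  have hsub : Ioo (-min (-a) b) (min (-a) b) ⊆ Ioo a b :=
    Ioo_subset_Ioo (by linarith [min_le_left (-a) b]) (min_le_right _ _)
  exact ⟨min (-a) b, γ, lt_min (by linarith) (by linarith), h.smooth.mono hsub,
    fun t ht => h.mem t (hsub ht), rfl, h.hasDerivAt ⟨ha, by linarith⟩⟩

theorem expMap_preSV (hk : ∀ i, 1 ≤ k i) (hα : 0 < α) {p v : FactorSpace n} (hp : p ∈ preSV n)
    (hv : v ∈ expDomain (preSV n) (preSVMetric α n k) p) :
    expMap (preSV n) (preSVMetric α n k) p v = preSVExpFormula α k p v := by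
  have ht : v ∈ tangentSpaceAt (preSV n) p := hv.choose_spec.mem_tangentSpaceAt
  have h := (mem_expDomain_preSV_iff hk hα hp ht).1 hv
  rw [← preSVGeodesic_one hk hα hp h]
  exact (Classical.epsilon_spec hv).eq_one hk hα
    (isStartingGeodesic_preSVGeodesic hk hα hp ((mem_tangentSpaceAt_preSV hp).1 ht) h)

/-- The image of the chosen geodesic upstairs is a starting geodesic downstairs. It need not be the
one chosen there, but the two agree on their common interval, which contains `1`. -/
theorem expMap_segreVeronese (hk : ∀ i, 1 ≤ k i) (hα : 0 < α) {p v : FactorSpace n}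
    (hv : v ∈ expDomain (preSV n) (preSVMetric α n k) p) :
    tangentTensor k p v ∈
        expDomain (segreVeronese n k) (alphaMetric α) (segreVeroneseMap k p) ∧
      expMap (segreVeronese n k) (alphaMetric α) (segreVeroneseMap k p) (tangentTensor k p v) =
        segreVeroneseMap k (expMap (preSV n) (preSVMetric α n k) p v) := by
  have hγ := Classical.epsilon_spec hv
  rw [expMap, expMap]
  set γ := Classical.epsilon (IsStartingGeodesic (preSV n) (preSVMetric α n k) p v)
  obtain ⟨h1, h2, a, b, ha, hb, h3⟩ := hγ
  have h0 : (0 : ℝ) ∈ Ioo a b := ⟨ha, by linarith⟩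
  have hdom : tangentTensor k p v ∈
      expDomain (segreVeronese n k) (alphaMetric α) (segreVeroneseMap k p) := by
    refine ⟨fun t => segreVeroneseMap k (γ t), congrArg (segreVeroneseMap k) h1, ?_, a, b, ha, hb,
      h3.segreVeroneseMap_comp hk⟩
    rw [deriv_segreVeroneseMap_comp h3.smooth h0, h1, h2]
  refine ⟨hdom, ?_⟩
  obtain ⟨h4, h5, a', b', ha', hb', h6⟩ := Classical.epsilon_spec hdom
  refine eqOn_segreVeroneseMap_comp hk hα
    (h3.mono (Ioo_subset_Ioo (le_max_left a a') (min_le_left b b')))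
    (h6.mono (Ioo_subset_Ioo (le_max_right a a') (min_le_right b b'))) (s := 0) ?_ ?_ ?_ ?_
  · exact ⟨max_lt ha ha', lt_min (by linarith) (by linarith)⟩
  · rw [h4, h1]
  · rw [h5, h1, h2]
  · exact ⟨max_lt (by linarith) (by linarith), lt_min hb hb'⟩

end Geodesics

end SegreVeronese

theorem mainTheorem2 {d : ℕ} (n k : Fin d → ℕ) (hk : ∀ i, 1 ≤ k i) (α : ℝ) (hα : 0 < α)
    (P : TensorSpace n k) (hP : P ∈ segreVeronese n k)
    (p : FactorSpace n) (hp : p ∈ preSV n) (hpP : segreVeroneseMap k p = P) :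
    -- every tangent vector at `P` has a unique lift to `p`
    (∀ P' ∈ tangentSpaceAt (segreVeronese n k) P,
      ∃! p' : FactorSpace n, p' ∈ tangentSpaceAt (preSV n) p ∧ P' = tangentTensor k p p') ∧
    -- the domain of the exponential map at `p`, and its closed formula
    (∀ p' ∈ tangentSpaceAt (preSV n) p,
      p' ∈ expDomain (preSV n) (preSVMetric α n k) p ↔ ¬ (p'.2 = 0 ∧ p'.1 ≤ -p.1)) ∧
    (∀ p' ∈ expDomain (preSV n) (preSVMetric α n k) p,
      expMap (preSV n) (preSVMetric α n k) p p' = preSVExpFormula α k p p') ∧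
    -- the exponential map at `P`
    (∀ P' ∈ tangentSpaceAt (segreVeronese n k) P, ∀ p' ∈ tangentSpaceAt (preSV n) p,
      P' = tangentTensor k p p' → p' ∈ expDomain (preSV n) (preSVMetric α n k) p →
        P' ∈ expDomain (segreVeronese n k) (alphaMetric α) P ∧
        expMap (segreVeronese n k) (alphaMetric α) P P' =
          segreVeroneseMap k (expMap (preSV n) (preSVMetric α n k) p p')) := by
  subst hpP
  refine ⟨fun P' hP' => ?_, fun p' hp' => mem_expDomain_preSV_iff hk hα hp hp',
    fun p' hp' => expMap_preSV hk hα hp hp', ?_⟩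
  · obtain ⟨v, hv, h⟩ := exists_eq_tangentTensor hk hp hP'
    exact ⟨v, ⟨hv, h⟩, fun w hw => tangentTensor_injOn hk p hw.1 hv (hw.2.symm.trans h)⟩
  · rintro P' - p' - rfl hp'
    exact expMap_segreVeronese hk hα hp'
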